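/- Write $\widehat{g}(\xi)=\int_{\mathbb{R}^2} g(x)e^{-\mathrm{i}\,x\cdot\xi}\,dx$, and let $\nu_2(g)=\sup\{s\in\mathbb{R}:\int_{\mathbb{R}^2}|\widehat g(\xi)|^2(1+\|\xi\|^2)^s\,d\xi<\infty\}$ be the Sobolev smoothness of $g$. For a unit vector $p=(\cos\theta,\sin\theta)$ let $\mathcal{R}_pf(t)=\int_{\mathbb{R}} f(t\cos\theta-s\sin\theta,\,t\sin\theta+s\cos\theta)\,ds$ be the Radon transform of $f$ in the direction $p$. For $S\subseteq\mathbb{R}^2$ let $\mathrm{dv}_S=\{x/\|x\|: 0\ne x\in S\}$ be its set of directions and $\mathcal{N}_S=\{0\neq y\in\mathbb{R}^2: x\cdot y=0\text{ for some }0\ne x\in S\}$ its null set. For a continuous $g:\mathbb{R}^2\to\mathbb{C}$ let $\mathrm{DV}_g=\bigcup_{g(x)\neq0}\mathrm{dv}_{D(x)}$, where $D(x)$ is the largest open disc centred at $x$ (of radius in $(0,\infty]$) on which $g$ has no zero. **Theorem 4.10.** Let $\varphi\in L^2(\mathbb{R}^2)$ (complex valued) be compactly supported with $\mathrm{supp}(\varphi)\subseteq[N_1,M_1]\times[N_2,M_2]$,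 let the system $\{\varphi(\cdot-k):k\in\mathbb{Z}^2\}$ be linearly independent in $L^2(\mathbb{R}^2)$, and suppose that (i) $\nu_2(\varphi)>1/2$, and (ii) $\widehat\varphi(0)=\int_{\mathbb{R}^2}\varphi(x)\,dx=0$. Let $a_1,b_1,a_2,b_2\in\mathbb{R}$ and let $W$ be the set of all $f$ in $V(\varphi,\mathbb{Z}^2)=\{\sum_{k\in\mathbb{Z}^2}c_k\varphi(\cdot-k):\sum_k|c_k|^2<\infty\}$ (sums convergent in $L^2(\mathbb{R}^2)$) such that $\mathrm{supp}(f)\subseteq[a_1,b_1]\times[a_2,b_2]$. Put $$E=\big([\lceil a_1-M_1\rceil,\lfloor b_1-N_1\rfloor]\times[\lceil a_2-M_2\rceil,\lfloor b_2-N_2\rfloor]\big)\cap\mathbb{Z}^2,\qquad E^+=\{x-y:\ x,y\in E,\ x\neq y\}.$$ Then the set of angles $\{\theta\in[0,2\pi):(\cos\theta,\sin\theta)\in\mathrm{DV}_{\widehat\varphi}\}$ has positive Lebesgue measure, $\mathrm{DV}_{\widehat\varphi}\setminus\mathrm{dv}_{\mathcal{N}_{E^+}}$ is not empty, and for every direction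 $p\in\mathrm{DV}_{\widehat\varphi}\setminus\mathrm{dv}_{\mathcal{N}_{E^+}}$ the following holds. For every $f\in W$ the Radon transform $\mathcal{R}_pf$ agrees almost everywhere with exactly one continuous function on $\mathbb{R}$, whose values are the Radon samples of $f$ in the direction $p$. Moreover there is a set $X_p\subseteq\mathbb{R}$ of cardinality $\#E$ such that every $f\in W$ is uniquely determined by its Radon samples at $X_p$: if $f_1,f_2\in W$ have the same Radon samples at all points of $X_p$, then $f_1=f_2$ in $L^2(\mathbb{R}^2)$. -/

import Mathlib

open MeasureTheory
open scoped ENNReal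

noncomputable section

namespace SingleAngleCT

/-- The Euclidean plane. -/
abbrev Plane : Type := EuclideanSpace ℝ (Fin 2)

/-- `L²(ℝ²)`, complex valued functions modulo almost everywhere equality. -/
abbrev L2Plane : Type := Lp ℂ 2 (volume : Measure Plane)

/-- The closed rectangle `[lo 0, hi 0] × [lo 1, hi 1]`. -/
def rectangle (lo hi : Fin 2 → ℝ) : Set Plane := {x | ∀ i, lo i ≤ x i ∧ x i ≤ hi i}

/-- `supp f ⊆ S` for a closed set `S` and a class `f` of functions modulo almost everywhere
equality: `f` vanishes almost everywhere outside `S`. -/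
def SupportedIn (f : L2Plane) (S : Set Plane) : Prop := ∀ᵐ x : Plane, x ∉ S → f x = 0

/-- The integer vector `k` as a point of the plane. -/
def latticePoint (k : Fin 2 → ℤ) : Plane := WithLp.toLp 2 fun i => (k i : ℝ)

/-- The shift `φ(· - k)`. -/
def shift (φ : L2Plane) (k : Fin 2 → ℤ) : L2Plane :=
  Lp.compMeasurePreserving (fun x : Plane => x - latticePoint k)
    (measurePreserving_sub_right volume (latticePoint k)) φ

theorem shift_ae (φ : L2Plane) (k : Fin 2 → ℤ) :
    shift φ k =ᵐ[volume] fun x => φ (x - latticePoint k) :=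
  Lp.coeFn_compMeasurePreserving φ (measurePreserving_sub_right volume (latticePoint k))

/-- The shift-invariant space `V(φ, ℤ²)`: all sums `∑ₖ cₖ φ(· - k)`, convergent in `L²(ℝ²)`, with
square summable coefficients. -/
def shiftInvariantSpace (φ : L2Plane) : Set L2Plane :=
  {f | ∃ c : (Fin 2 → ℤ) → ℂ, Summable (fun k => ‖c k‖ ^ 2) ∧ HasSum (fun k => c k • shift φ k) f}

/-- The possible target functions: the elements of `V(φ, ℤ²)` with support in the rectangle
`[a 0, b 0] × [a 1, b 1]`. -/
def targets (φ : L2Plane) (a b : Fin 2 → ℝ) : Set L2Plane :=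
  {f | f ∈ shiftInvariantSpace φ ∧ SupportedIn f (rectangle a b)}

/-- The Fourier transform `ĝ(ξ) = ∫ g(x) exp(-i x·ξ) dx` of an integrable function. (It is applied
below to compactly supported square integrable functions, which are integrable.) -/
def fourierHat (g : Plane → ℂ) (ξ : Plane) : ℂ :=
  ∫ x : Plane, Complex.exp (-(Complex.I * ((inner ℝ x ξ : ℝ) : ℂ))) * g x

/-- The integral `∫ |ĝ(ξ)|² (1 + ‖ξ‖²)^s dξ` that defines `H^s(ℝ²)` is finite. -/
def HasSobolevOrder (g : Plane → ℂ) (s : ℝ) : Prop :=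
  ∫⁻ ξ : Plane, ENNReal.ofReal (‖fourierHat g ξ‖ ^ 2 * (1 + ‖ξ‖ ^ 2) ^ s) < ∞

/-- The Sobolev smoothness `ν₂(g) = sup {s | g ∈ H^s(ℝ²)}`, an extended real number. -/
def sobolevSmoothness (g : Plane → ℂ) : EReal :=
  sSup ((fun s : ℝ => (s : EReal)) '' {s : ℝ | HasSobolevOrder g s})

/-- The Radon transform of `f` in the direction `p = (cos θ, sin θ)`: its value at `t` is the
integral of `f` along the line `s ↦ t (cos θ, sin θ) + s (-sin θ, cos θ)`. -/
def radon (p : Plane) (f : Plane → ℂ) (t : ℝ) : ℂ :=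
  ∫ s : ℝ, f !₂[t * p 0 - s * p 1, t * p 1 + s * p 0]

/-- `g` is the continuous version of the Radon transform of `f` in the direction `p`. The Radon
transform of a class `f` of functions modulo almost everywhere equality is itself determined only
almost everywhere on the line; its samples are the values of its continuous version. There is at
most one continuous version. -/
def IsContinuousRadon (p : Plane) (f : L2Plane) (g : ℝ → ℂ) : Prop :=
  Continuous g ∧ g =ᵐ[volume] radon p f

/-- The direction vector set `dv S`: the directions `(cos θ, sin θ)` of the nonzero points
`x = ‖x‖ (cos θ, sin θ)` of `S`. It is empty if `S` has no nonzero point. -/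
def directionSet (S : Set Plane) : Set Plane :=
  {p | (∃ θ : ℝ, p = !₂[Real.cos θ, Real.sin θ]) ∧ ∃ x ∈ S, x ≠ 0 ∧ x = ‖x‖ • p}

/-- The null set of `S`: the nonzero points that are orthogonal to some nonzero point of `S`. It is
empty if `S` has no nonzero point. -/
def nullSet (S : Set Plane) : Set Plane :=
  {y | y ≠ 0 ∧ ∃ x ∈ S, x ≠ 0 ∧ inner ℝ x y = 0}

/-- The open disc of radius `δ ∈ [0, ∞]`. -/
def openDisc (x : Plane) (δ : ℝ≥0∞) : Set Plane := {y | edist y x < δ}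

/-- The largest `δ` such that `g` has no zero in the open disc of radius `δ` around `x`. -/
def maxRadius (g : Plane → ℂ) (x : Plane) : ℝ≥0∞ := sSup {δ | ∀ y ∈ openDisc x δ, g y ≠ 0}

/-- The supremum in `maxRadius` is attained. -/
theorem ne_zero_of_mem_openDisc_maxRadius (g : Plane → ℂ) (x : Plane) :
    ∀ y ∈ openDisc x (maxRadius g x), g y ≠ 0 := by
  intro y hy
  obtain ⟨δ, hδ, hlt⟩ := lt_sSup_iff.1 (show edist y x < sSup _ from hy)
  exact hδ y hlt

/-- The set `DV g`: the union, over all points `x` with `g x ≠ 0`, of the direction vector sets of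
the largest open discs around `x` on which `g` has no zero. -/
def flagDirections (g : Plane → ℂ) : Set Plane :=
  ⋃ x ∈ {x : Plane | g x ≠ 0}, directionSet (openDisc x (maxRadius g x))

/-- The angle set of a set of directions. -/
def angleSet (D : Set Plane) : Set ℝ :=
  {θ | θ ∈ Set.Ico 0 (2 * Real.pi) ∧ !₂[Real.cos θ, Real.sin θ] ∈ D}

/-- The index set `E`: the integer points of
`[⌈a 0 - M 0⌉, ⌊b 0 - N 0⌋] × [⌈a 1 - M 1⌉, ⌊b 1 - N 1⌋]`. -/
def indexSet (N M a b : Fin 2 → ℝ) : Finset (Fin 2 → ℤ) :=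
  Finset.Icc (fun i => ⌈a i - M i⌉) (fun i => ⌊b i - N i⌋)

/-- The set `E⁺` of the differences of distinct elements of `E`. It is empty if `E` has at most one
element. -/
def differenceSet (E : Finset (Fin 2 → ℤ)) : Set Plane :=
  {z | ∃ k ∈ E, ∃ l ∈ E, k ≠ l ∧ z = latticePoint k - latticePoint l}

end SingleAngleCT

end

open SingleAngleCT

/-! Existence of samples. On the line `ℝp` the transform `fourierHat f` is, up to scaling, the
Fourier transform of `radon p f`, so integrability there yields a continuous version. Sobolev order
`s > 1/2` gives, by Cauchy–Schwarz, only that the integrals of `|φ̂|` over the lines parallel to `p`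
are square integrable in the offset; the line through the origin may be exceptional. But `f = χ f`
for a smooth cutoff `χ`, so `f` is a finite sum of terms `χ φ(· - k)`, and multiplication by `χ`
averages the transform over parallel lines (`integrable_fourierHat_schwartz_mul`).

Injectivity. The coefficients of `f` may be nonzero outside `indexSet`, so `f` cannot be treated as
a sum over that set. Instead, for representatives `Φ`, `F` and a fixed `x`, both functions `∑ Φ(x +
l) F(· - l)` and `∑ F(x + j) Φ(· - j)` agree (`tsum_mul_eq_tsum_mul`). If the Radon transform of `f`
vanishes, so does `F̂` on `ℝp`, hence `Φ̂(τp) ∑ F(x + j) exp(-iτ j·p) = 0`. Since `Φ̂` is nonzero at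
some point of `ℝp`, it is nonzero for an open set of `τ`; the frequencies `j·p` are distinct off the
null directions; so every `F(x + j)` is zero (`eq_zero_of_radon_ae_eq_zero`).

Counting. Truncated to the rectangle, the shifts indexed by `indexSet` span a space containing all
targets, and a linear family of functions of dimension at most `n` is determined by `n` suitable
points (`exists_finset_card_eq_forall_eq_zero`). Admissible directions exist because a set of angles
of positive measure is not exhausted by countably many. -/

namespace SingleAngleCT

/-! ### Fourier inversion almost everywhere, and injectivity on integrable functions -/

section FourierInversion

open FourierTransform SchwartzMap

variable {V : Type*} [NormedAddCommGroup V] [InnerProductSpace ℝ V] [FiniteDimensional ℝ V]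
  [MeasurableSpace V] [BorelSpace V]

theorem continuous_fourier_of_integrable {f : V → ℂ} (hf : Integrable f) : Continuous (𝓕 f) :=
  VectorFourier.fourierIntegral_continuous Real.continuous_fourierChar
    (by exact continuous_inner) hf

theorem continuous_fourierInv_of_integrable {f : V → ℂ} (hf : Integrable f) :
    Continuous (𝓕⁻ f) :=
  VectorFourier.fourierIntegral_continuous Real.continuous_fourierChar
    (by exact continuous_inner.neg) hf

/-- Fourier inversion almost everywhere, without a continuity assumption. -/
theorem ae_eq_fourierInv_fourier {f : V → ℂ} (hf : Integrable f) (hf' : Integrable (𝓕 f)) :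
    f =ᵐ[volume] 𝓕⁻ (𝓕 f) := by
  refine ae_eq_of_integral_contDiff_smul_eq hf.locallyIntegrable
    (continuous_fourierInv_of_integrable hf').locallyIntegrable ?_
  intro g hg hgs
  have hGs : HasCompactSupport fun x => (g x : ℂ) :=
    hgs.comp_left (g := fun r : ℝ => (r : ℂ)) Complex.ofReal_zero
  have hGd : ContDiff ℝ ((⊤ : ℕ∞) : WithTop ℕ∞) fun x => (g x : ℂ) :=
    Complex.ofRealCLM.contDiff.comp hg
  let G : 𝓢(V, ℂ) := hGs.toSchwartzMap hGd
  let G' : 𝓢(V, ℂ) := 𝓕⁻ G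
  have hG : ∀ x, G x = (g x : ℂ) := fun x => rfl
  -- The transform moves across the pairing twice: `G` is the transform of the Schwartz function
  -- `G'`, and `G'` is the inverse transform of `G`.
  have h1 : ∫ x, G x • f x = ∫ x, G' x • 𝓕 f x := by
    have hinv : 𝓕 G' = G := FourierTransform.fourier_fourierInv_eq G
    have := VectorFourier.integral_fourierIntegral_smul_eq_flip (L := innerₗ V)
      (μ := (volume : Measure V)) (ν := volume) Real.continuous_fourierChar
      (by exact continuous_inner) (f := G') (g := f) G'.integrable hf
    rw [flip_innerₗ] at this
    change ∫ x, 𝓕 (⇑G') x • f x = ∫ x, G' x • 𝓕 f x at this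
    rw [← this, ← SchwartzMap.fourier_coe, hinv]
  have h2 : ∫ x, G' x • 𝓕 f x = ∫ x, G x • 𝓕⁻ (𝓕 f) x := by
    have := VectorFourier.integral_fourierIntegral_smul_eq_flip (L := -innerₗ V)
      (μ := (volume : Measure V)) (ν := volume) Real.continuous_fourierChar
      (by exact continuous_inner.neg) (f := G) (g := 𝓕 f) G.integrable hf'
    have hflip : (-innerₗ V).flip = -innerₗ V := by
      ext x y
      simp [real_inner_comm]
    rw [hflip] at this
    rw [show G' = 𝓕⁻ G from rfl, SchwartzMap.fourierInv_coe]
    exact this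
  simpa [hG] using h1.trans h2

theorem ae_eq_zero_of_fourier_eq_zero {f : V → ℂ} (hf : Integrable f) (h : ∀ ξ, 𝓕 f ξ = 0) :
    f =ᵐ[volume] 0 := by
  have h0 : 𝓕 f = 0 := funext h
  have := ae_eq_fourierInv_fourier hf (by rw [h0]; exact integrable_zero _ _ _)
  rw [h0] at this
  filter_upwards [this] with x hx
  rw [hx, Real.fourierInv_eq]
  simp

end FourierInversion

/-! ### The transform with kernel `exp(-i x·ξ)` -/

section FourierHat

open FourierTransform

theorem fourierHat_eq_fourier (g : Plane → ℂ) (ξ : Plane) :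
    fourierHat g ξ = 𝓕 g ((2 * Real.pi)⁻¹ • ξ) := by
  rw [Real.fourier_eq', fourierHat]
  congr 1 with x
  rw [smul_eq_mul, inner_smul_right]
  congr 2
  have : (Real.pi : ℂ) ≠ 0 := by exact_mod_cast Real.pi_ne_zero
  push_cast
  field_simp

theorem fourierHat_congr {f g : Plane → ℂ} (h : f =ᵐ[volume] g) : fourierHat f = fourierHat g := by
  ext ξ
  refine integral_congr_ae ?_
  filter_upwards [h] with x hx
  rw [hx]

theorem continuous_fourierHat {g : Plane → ℂ} (hg : Integrable g) : Continuous (fourierHat g) := by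
  have : fourierHat g = fun ξ => 𝓕 g ((2 * Real.pi)⁻¹ • ξ) := funext (fourierHat_eq_fourier g)
  rw [this]
  exact (continuous_fourier_of_integrable hg).comp (continuous_const_smul _)

theorem ae_eq_zero_of_fourierHat_eq_zero {g : Plane → ℂ} (hg : Integrable g)
    (h : ∀ ξ, fourierHat g ξ = 0) : g =ᵐ[volume] 0 := by
  refine ae_eq_zero_of_fourier_eq_zero hg fun ξ => ?_
  have := h ((2 * Real.pi) • ξ)
  rwa [fourierHat_eq_fourier, smul_smul, inv_mul_cancel₀ (by positivity), one_smul] at this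

theorem norm_exp_neg_I_mul (r : ℝ) : ‖Complex.exp (-(Complex.I * (r : ℂ)))‖ = 1 := by
  rw [show -(Complex.I * (r : ℂ)) = ((-r : ℝ) : ℂ) * Complex.I by push_cast; ring,
    Complex.norm_exp_ofReal_mul_I]

theorem integrable_exp_mul {g : Plane → ℂ} (hg : Integrable g) (ξ : Plane) :
    Integrable fun x : Plane => Complex.exp (-(Complex.I * ((inner ℝ x ξ : ℝ) : ℂ))) * g x := by
  refine hg.bdd_mul (c := 1) (Continuous.aestronglyMeasurable (by fun_prop)) ?_
  exact Filter.Eventually.of_forall fun x => (norm_exp_neg_I_mul _).le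

theorem fourierHat_comp_sub (g : Plane → ℂ) (y ξ : Plane) :
    fourierHat (fun x => g (x - y)) ξ =
      Complex.exp (-(Complex.I * ((inner ℝ y ξ : ℝ) : ℂ))) * fourierHat g ξ := by
  rw [fourierHat, fourierHat, ← integral_const_mul,
    ← integral_add_right_eq_self (μ := (volume : Measure Plane)) _ y]
  congr 1 with x
  rw [add_sub_cancel_right, inner_add_left, ← mul_assoc, ← Complex.exp_add]
  congr 2
  push_cast
  ring

theorem fourierHat_const_mul (c : ℂ) (g : Plane → ℂ) (ξ : Plane) :
    fourierHat (fun x => c * g x) ξ = c * fourierHat g ξ := by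
  rw [fourierHat, fourierHat, ← integral_const_mul]
  congr 1 with x
  ring

theorem fourierHat_sum {ι : Type*} (s : Finset ι) (g : ι → Plane → ℂ)
    (hg : ∀ i ∈ s, Integrable (g i)) (ξ : Plane) :
    fourierHat (fun x => ∑ i ∈ s, g i x) ξ = ∑ i ∈ s, fourierHat (g i) ξ := by
  simp only [fourierHat, Finset.mul_sum]
  exact integral_finsetSum s fun i hi => integrable_exp_mul (hg i hi) ξ

theorem hasSobolevOrder_comp_sub {g : Plane → ℂ} {s : ℝ} (hg : HasSobolevOrder g s) (y : Plane) :
    HasSobolevOrder (fun x => g (x - y)) s := by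
  unfold HasSobolevOrder at hg ⊢
  simpa only [fourierHat_comp_sub, norm_mul, norm_exp_neg_I_mul, one_mul] using hg

theorem HasSobolevOrder.congr {f g : Plane → ℂ} {s : ℝ} (hg : HasSobolevOrder g s)
    (h : f =ᵐ[volume] g) : HasSobolevOrder f s := by
  unfold HasSobolevOrder
  rw [fourierHat_congr h]
  exact hg

end FourierHat

/-! ### Rotated coordinates, the Radon transform and the Fourier slice theorem -/

section Rotation

/-- The coordinates along and across the direction `p`. -/
def rotation (p : Plane) (z : ℝ × ℝ) : Plane := !₂[z.1 * p 0 - z.2 * p 1, z.1 * p 1 + z.2 * p 0]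

theorem continuous_rotation (p : Plane) : Continuous (rotation p) := by
  unfold rotation
  refine (PiLp.continuous_toLp 2 _).comp (continuous_pi fun i => ?_)
  fin_cases i <;> simp <;> fun_prop

theorem measurePreserving_rotation {p : Plane} (hp : p 0 ^ 2 + p 1 ^ 2 = 1) :
    MeasurePreserving (rotation p) (volume : Measure (ℝ × ℝ)) (volume : Measure Plane) := by
  have h1 := (volume_preserving_finTwoArrow ℝ).symm
  let A : Matrix (Fin 2) (Fin 2) ℝ := !![p 0, -p 1; p 1, p 0]
  have hdet : A.det = 1 := by
    simp only [A, Matrix.det_fin_two_of]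
    linarith
  have h2 : MeasurePreserving (Matrix.toLin' A) (volume : Measure (Fin 2 → ℝ)) volume := by
    refine ⟨(Matrix.toLin' A).continuous_of_finiteDimensional.measurable, ?_⟩
    rw [Real.map_matrix_volume_pi_eq_smul_volume_pi (by rw [hdet]; norm_num), hdet]
    simp
  have h3 := PiLp.volume_preserving_toLp (Fin 2)
  have h := h3.comp (h2.comp h1)
  have heq : rotation p =
      WithLp.toLp 2 ∘ Matrix.toLin' A ∘ (MeasurableEquiv.finTwoArrow (α := ℝ)).symm := by
    funext z
    refine PiLp.ext fun i => ?_
    fin_cases i <;> simp [rotation, A, MeasurableEquiv.finTwoArrow, Matrix.toLin'_apply]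
    ring
  rw [heq]
  exact h

theorem rotation_injective {p : Plane} (hp : p 0 ^ 2 + p 1 ^ 2 = 1) :
    Function.Injective (rotation p) := by
  intro z w h
  have h0 : z.1 * p 0 - z.2 * p 1 = w.1 * p 0 - w.2 * p 1 := congrArg (fun x : Plane => x 0) h
  have h1 : z.1 * p 1 + z.2 * p 0 = w.1 * p 1 + w.2 * p 0 := congrArg (fun x : Plane => x 1) h
  ext
  · linear_combination p 0 * h0 + p 1 * h1 - (z.1 - w.1) * hp
  · linear_combination -p 1 * h0 + p 0 * h1 - (z.2 - w.2) * hp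

theorem measurableEmbedding_rotation {p : Plane} (hp : p 0 ^ 2 + p 1 ^ 2 = 1) :
    MeasurableEmbedding (rotation p) :=
  (continuous_rotation p).measurableEmbedding (rotation_injective hp)

theorem rotation_sub (p : Plane) (z w : ℝ × ℝ) :
    rotation p (z - w) = rotation p z - rotation p w := by
  ext i
  fin_cases i <;> simp [rotation] <;> ring

theorem rotation_smul (p : Plane) (c : ℝ) (z : ℝ × ℝ) :
    rotation p (c • z) = c • rotation p z := by
  ext i
  fin_cases i <;> simp [rotation] <;> ring

theorem rotation_fst (p : Plane) (t : ℝ) : rotation p (t, 0) = t • p := by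
  ext i
  fin_cases i <;> simp [rotation]

theorem norm_rotation_sq {p : Plane} (hp : p 0 ^ 2 + p 1 ^ 2 = 1) (z : ℝ × ℝ) :
    ‖rotation p z‖ ^ 2 = z.1 ^ 2 + z.2 ^ 2 := by
  rw [EuclideanSpace.norm_sq_eq]
  simp [rotation, Fin.sum_univ_two]
  linear_combination (z.1 ^ 2 + z.2 ^ 2) * hp

theorem inner_rotation_smul {p : Plane} (hp : p 0 ^ 2 + p 1 ^ 2 = 1) (z : ℝ × ℝ) (τ : ℝ) :
    inner ℝ (rotation p z) (τ • p) = τ * z.1 := by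
  simp [rotation, PiLp.inner_apply, Fin.sum_univ_two]
  linear_combination (τ * z.1) * hp

theorem integrable_comp_rotation {p : Plane} (hp : p 0 ^ 2 + p 1 ^ 2 = 1) {f : Plane → ℂ}
    (hf : Integrable f) : Integrable fun z : ℝ × ℝ => f (rotation p z) :=
  ((measurePreserving_rotation hp).integrable_comp_emb (measurableEmbedding_rotation hp)).2 hf

theorem integrable_radon {p : Plane} (hp : p 0 ^ 2 + p 1 ^ 2 = 1) {f : Plane → ℂ}
    (hf : Integrable f) : Integrable (radon p f) :=
  (integrable_comp_rotation hp hf).integral_prod_left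

theorem radon_congr {p : Plane} (hp : p 0 ^ 2 + p 1 ^ 2 = 1) {f g : Plane → ℂ}
    (h : f =ᵐ[volume] g) : radon p f =ᵐ[volume] radon p g := by
  have h1 : ∀ᵐ z : ℝ × ℝ, f (rotation p z) = g (rotation p z) :=
    (measurePreserving_rotation hp).quasiMeasurePreserving.ae h
  filter_upwards [Measure.ae_ae_of_ae_prod h1] with t ht
  exact integral_congr_ae ht

theorem radon_add {p : Plane} (hp : p 0 ^ 2 + p 1 ^ 2 = 1) {f g : Plane → ℂ}
    (hf : Integrable f) (hg : Integrable g) :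
    radon p (f + g) =ᵐ[volume] radon p f + radon p g := by
  filter_upwards [(integrable_comp_rotation hp hf).prod_right_ae,
    (integrable_comp_rotation hp hg).prod_right_ae] with t h1 h2
  exact integral_add h1 h2

theorem radon_const_smul (p : Plane) (c : ℂ) (f : Plane → ℂ) :
    radon p (c • f) = c • radon p f := by
  ext t
  exact integral_const_mul c _

/-- The Fourier slice theorem. -/
theorem fourierHat_smul_eq_integral_radon {p : Plane} (hp : p 0 ^ 2 + p 1 ^ 2 = 1)
    {f : Plane → ℂ} (hf : Integrable f) (τ : ℝ) :
    fourierHat f (τ • p) = ∫ t : ℝ, Complex.exp (-(Complex.I * ((τ * t : ℝ) : ℂ))) * radon p f t := by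
  have h := integrable_exp_mul hf (τ • p)
  rw [fourierHat, ← (measurePreserving_rotation hp).integral_comp (measurableEmbedding_rotation hp),
    Measure.volume_eq_prod, integral_prod _ (integrable_comp_rotation hp h)]
  congr 1 with t
  rw [radon, ← integral_const_mul]
  congr 1 with s
  rw [inner_rotation_smul hp]
  rfl

open FourierTransform in
theorem fourierHat_smul_eq_fourier_radon {p : Plane} (hp : p 0 ^ 2 + p 1 ^ 2 = 1)
    {f : Plane → ℂ} (hf : Integrable f) (τ : ℝ) :
    fourierHat f (τ • p) = 𝓕 (radon p f) ((2 * Real.pi)⁻¹ * τ) := by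
  rw [fourierHat_smul_eq_integral_radon hp hf, Real.fourier_real_eq_integral_exp_smul]
  congr 1 with t
  rw [smul_eq_mul]
  congr 2
  have : (Real.pi : ℂ) ≠ 0 := by exact_mod_cast Real.pi_ne_zero
  push_cast
  field_simp

open FourierTransform in
/-- The Radon transform has a continuous version if the Fourier transform is integrable along the
direction. -/
theorem exists_continuous_ae_eq_radon {p : Plane} (hp : p 0 ^ 2 + p 1 ^ 2 = 1)
    {f : Plane → ℂ} (hf : Integrable f) (h : Integrable fun τ : ℝ => fourierHat f (τ • p)) :
    ∃ g : ℝ → ℂ, Continuous g ∧ g =ᵐ[volume] radon p f := by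
  have h1 : Integrable (𝓕 (radon p f)) := by
    have := h.comp_mul_left' (R := 2 * Real.pi) (by positivity)
    refine this.congr (Filter.Eventually.of_forall fun τ => ?_)
    dsimp only
    rw [fourierHat_smul_eq_fourier_radon hp hf, ← mul_assoc, inv_mul_cancel₀ (by positivity),
      one_mul]
  exact ⟨_, continuous_fourierInv_of_integrable h1,
    (ae_eq_fourierInv_fourier (integrable_radon hp hf) h1).symm⟩

end Rotation

/-! ### Integrability of the Fourier transform along a line -/

section SobolevSlice

theorem sq_lintegral_mul_le {α : Type*} [MeasurableSpace α] {μ : Measure α} {f g : α → ℝ≥0∞}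
    (hf : Measurable f) (hg : Measurable g) :
    (∫⁻ a, f a * g a ∂μ) ^ 2 ≤ (∫⁻ a, f a ^ 2 ∂μ) * ∫⁻ a, g a ^ 2 ∂μ := by
  have h := ENNReal.lintegral_mul_le_Lp_mul_Lq μ Real.HolderConjugate.two_two
    hf.aemeasurable hg.aemeasurable
  simp only [Pi.mul_apply, ENNReal.rpow_two] at h
  calc (∫⁻ a, f a * g a ∂μ) ^ 2
      ≤ ((∫⁻ a, f a ^ 2 ∂μ) ^ (1 / 2 : ℝ) * (∫⁻ a, g a ^ 2 ∂μ) ^ (1 / 2 : ℝ)) ^ 2 := by gcongr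
    _ = _ := by
        rw [mul_pow, ← ENNReal.rpow_two, ← ENNReal.rpow_two, ← ENNReal.rpow_mul,
          ← ENNReal.rpow_mul]
        norm_num

theorem lintegral_comp_mul_left {F : ℝ → ℝ≥0∞} (hF : Measurable F) {a : ℝ} (ha : a ≠ 0) :
    ∫⁻ v, F (a * v) = ENNReal.ofReal |a⁻¹| * ∫⁻ v, F v := by
  rw [← lintegral_map hF (measurable_const_mul a), Real.map_volume_mul_left ha,
    lintegral_smul_measure, smul_eq_mul]

theorem lintegral_one_add_sq_rpow_lt_top {s : ℝ} (hs : 1 / 2 < s) :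
    ∫⁻ t : ℝ, ENNReal.ofReal ((1 + t ^ 2) ^ (-s)) < ∞ := by
  have h := integrable_rpow_neg_one_add_norm_sq (E := ℝ) (μ := volume) (r := 2 * s)
    (by simp; linarith)
  have h2 := h.lintegral_lt_top
  convert h2 using 4 with t
  rw [Real.norm_eq_abs, sq_abs]
  congr 1
  ring

/-- The Cauchy–Schwarz estimate behind the trace theorem. -/
theorem sq_lintegral_le_weighted {h : ℝ → ℝ≥0∞} (hh : Measurable h) {s : ℝ} (hs : 0 < s) (v : ℝ) :
    (∫⁻ t, h t) ^ 2 ≤ (∫⁻ t : ℝ, ENNReal.ofReal ((1 + t ^ 2) ^ (-s))) *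
      ∫⁻ t, h t ^ 2 * ENNReal.ofReal ((1 + (t ^ 2 + v ^ 2)) ^ s) := by
  have hpos : ∀ t : ℝ, 0 < 1 + (t ^ 2 + v ^ 2) := fun t => by positivity
  have hmeas : ∀ r : ℝ, Measurable fun t : ℝ => ENNReal.ofReal ((1 + (t ^ 2 + v ^ 2)) ^ r) := by
    intro r
    fun_prop
  -- The weight is split as `h = w^(-s/2) · (h w^(s/2))`; dropping `v²` from the first factor then
  -- makes its bound independent of `v`.
  have key := sq_lintegral_mul_le (μ := volume)
    (f := fun t : ℝ => ENNReal.ofReal ((1 + (t ^ 2 + v ^ 2)) ^ (-s / 2)))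
    (g := fun t => h t * ENNReal.ofReal ((1 + (t ^ 2 + v ^ 2)) ^ (s / 2)))
    (hmeas _) (hh.mul (hmeas _))
  have e1 : ∀ t : ℝ, ENNReal.ofReal ((1 + (t ^ 2 + v ^ 2)) ^ (-s / 2)) *
      (h t * ENNReal.ofReal ((1 + (t ^ 2 + v ^ 2)) ^ (s / 2))) = h t := by
    intro t
    rw [mul_left_comm, ← ENNReal.ofReal_mul (by positivity), ← Real.rpow_add (hpos t),
      show -s / 2 + s / 2 = 0 by ring, Real.rpow_zero, ENNReal.ofReal_one, mul_one]
  have e2 : ∀ r t : ℝ, ENNReal.ofReal ((1 + (t ^ 2 + v ^ 2)) ^ (r / 2)) ^ 2 =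
      ENNReal.ofReal ((1 + (t ^ 2 + v ^ 2)) ^ r) := by
    intro r t
    rw [← ENNReal.ofReal_pow (by have := hpos t; positivity), ← Real.rpow_natCast,
      ← Real.rpow_mul (hpos t).le]
    congr 2
    push_cast
    ring
  simp only [e1, mul_pow, e2] at key
  refine key.trans ?_
  refine mul_le_mul_left (lintegral_mono fun t => ENNReal.ofReal_le_ofReal ?_) _
  refine Real.rpow_le_rpow_of_nonpos (by positivity) ?_ (by linarith)
  nlinarith [sq_nonneg v]

/-- The Cauchy–Schwarz constant on each line is finite because `s > 1/2` and does not depend on the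
offset `v`, so integrating over `v` recovers the planar weighted integral. -/
theorem lintegral_sq_lintegral_lt_top {H : ℝ × ℝ → ℝ≥0∞} (hH : Measurable H) {s : ℝ}
    (hs : 1 / 2 < s)
    (hfin : ∫⁻ z, H z ^ 2 * ENNReal.ofReal ((1 + (z.1 ^ 2 + z.2 ^ 2)) ^ s) < ∞) :
    ∫⁻ v : ℝ, (∫⁻ t : ℝ, H (t, v)) ^ 2 < ∞ := by
  have hm : Measurable fun z : ℝ × ℝ =>
      H z ^ 2 * ENNReal.ofReal ((1 + (z.1 ^ 2 + z.2 ^ 2)) ^ s) := by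
    refine (hH.pow_const 2).mul ?_
    fun_prop
  calc ∫⁻ v : ℝ, (∫⁻ t : ℝ, H (t, v)) ^ 2
      ≤ ∫⁻ v : ℝ, (∫⁻ t : ℝ, ENNReal.ofReal ((1 + t ^ 2) ^ (-s))) *
        ∫⁻ t, H (t, v) ^ 2 * ENNReal.ofReal ((1 + (t ^ 2 + v ^ 2)) ^ s) :=
        lintegral_mono fun v =>
          sq_lintegral_le_weighted (hH.comp measurable_prodMk_right) (by linarith) v
    _ = (∫⁻ t : ℝ, ENNReal.ofReal ((1 + t ^ 2) ^ (-s))) *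
        ∫⁻ v : ℝ, ∫⁻ t : ℝ, H (t, v) ^ 2 * ENNReal.ofReal ((1 + (t ^ 2 + v ^ 2)) ^ s) :=
        lintegral_const_mul _ hm.lintegral_prod_left'
    _ = (∫⁻ t : ℝ, ENNReal.ofReal ((1 + t ^ 2) ^ (-s))) *
        ∫⁻ z, H z ^ 2 * ENNReal.ofReal ((1 + (z.1 ^ 2 + z.2 ^ 2)) ^ s) := by
        rw [Measure.volume_eq_prod, lintegral_prod_symm' _ hm]
    _ < ∞ := ENNReal.mul_lt_top (lintegral_one_add_sq_rpow_lt_top hs) hfin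

open SchwartzMap in
theorem exists_norm_le_rpow (X : 𝓢(Plane, ℂ)) :
    ∃ C : ℝ, 0 ≤ C ∧ ∀ x, ‖X x‖ ≤ C * (1 + ‖x‖ ^ 2) ^ (-2 : ℝ) := by
  refine ⟨2 ^ 4 * (Finset.Iic (4, 0)).sup (fun m => SchwartzMap.seminorm ℝ m.1 m.2) X,
    by positivity, fun x => ?_⟩
  have h := SchwartzMap.one_add_le_sup_seminorm_apply (𝕜 := ℝ) (m := (4, 0)) (k := 4) (n := 0)
    le_rfl le_rfl X x
  rw [norm_iteratedFDeriv_zero] at h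
  rw [Real.rpow_neg (by positivity), ← div_eq_mul_inv, le_div_iff₀ (by positivity), mul_comm]
  refine le_trans ?_ h
  gcongr
  rw [show (2 : ℝ) = ((2 : ℕ) : ℝ) by norm_num, Real.rpow_natCast,
    show (1 + ‖x‖) ^ 4 = ((1 + ‖x‖) ^ 2) ^ 2 by ring]
  gcongr
  nlinarith [norm_nonneg x]

open SchwartzMap in
-- With the weight of order `1`, the decay of `X` absorbs the weight and one factor `‖X‖`, leaving a
-- multiple of the integrable function `‖X‖`.
theorem lintegral_sq_lintegral_schwartz_lt_top {p : Plane} (hp : p 0 ^ 2 + p 1 ^ 2 = 1)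
    (X : 𝓢(Plane, ℂ)) : ∫⁻ v : ℝ, (∫⁻ u : ℝ, ‖X (rotation p (u, v))‖ₑ) ^ 2 < ∞ := by
  refine lintegral_sq_lintegral_lt_top (s := 1)
    (X.continuous.comp (continuous_rotation p)).enorm.measurable (by norm_num) ?_
  have h := (((X.integrable (μ := (volume : Measure Plane))).norm.const_mul
    ((exists_norm_le_rpow X).choose)).lintegral_lt_top)
  have hC := (exists_norm_le_rpow X).choose_spec
  rw [← (measurePreserving_rotation hp).lintegral_comp_emb (measurableEmbedding_rotation hp)] at h
  refine lt_of_le_of_lt (lintegral_mono fun z => ?_) h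
  rw [← ofReal_norm, ← ENNReal.ofReal_pow (norm_nonneg _),
    ← ENNReal.ofReal_mul (by positivity), Real.rpow_one, ← norm_rotation_sq hp z]
  refine ENNReal.ofReal_le_ofReal ?_
  set y := rotation p z
  have h1 := hC.2 y
  have h2 : (1 + ‖y‖ ^ 2) ^ (-2 : ℝ) * (1 + ‖y‖ ^ 2) ≤ 1 := by
    have h0 : (0 : ℝ) < 1 + ‖y‖ ^ 2 := by positivity
    nth_rewrite 2 [← Real.rpow_one (1 + ‖y‖ ^ 2)]
    rw [← Real.rpow_add h0]
    exact Real.rpow_le_one_of_one_le_of_nonpos (by nlinarith [sq_nonneg ‖y‖]) (by norm_num)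
  set C := (exists_norm_le_rpow X).choose
  calc ‖X y‖ ^ 2 * (1 + ‖y‖ ^ 2) = ‖X y‖ * (1 + ‖y‖ ^ 2) * ‖X y‖ := by ring
    _ ≤ C * (1 + ‖y‖ ^ 2) ^ (-2 : ℝ) * (1 + ‖y‖ ^ 2) * ‖X y‖ := by gcongr
    _ = C * ((1 + ‖y‖ ^ 2) ^ (-2 : ℝ) * (1 + ‖y‖ ^ 2)) * ‖X y‖ := by ring
    _ ≤ C * 1 * ‖X y‖ := by
        have := hC.1
        gcongr
    _ = C * ‖X y‖ := by ring

open SchwartzMap FourierTransform in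
/-- The Fourier transform of a product as a convolution. -/
theorem fourierHat_schwartz_mul (χ : 𝓢(Plane, ℂ)) {g : Plane → ℂ} (hg : Integrable g)
    (ξ : Plane) :
    fourierHat (fun x => χ x * g x) ξ =
      ∫ η, (𝓕 χ) η * fourierHat g (ξ - (2 * Real.pi) • η) := by
  let X : 𝓢(Plane, ℂ) := 𝓕 χ
  have hinv : 𝓕⁻ X = χ := FourierTransform.fourierInv_fourier_eq χ
  have := VectorFourier.integral_fourierIntegral_smul_eq_flip (L := -innerₗ Plane)
    (μ := (volume : Measure Plane)) (ν := volume) Real.continuous_fourierChar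
    (by exact continuous_inner.neg) (f := X) X.integrable (integrable_exp_mul hg ξ)
  have hflip : (-innerₗ Plane).flip = -innerₗ Plane := by
    ext x y
    simp [real_inner_comm]
  rw [hflip] at this
  change ∫ x, 𝓕⁻ (⇑X) x • (Complex.exp (-(Complex.I * ((inner ℝ x ξ : ℝ) : ℂ))) * g x) =
    ∫ η, X η • 𝓕⁻ (fun x : Plane =>
      Complex.exp (-(Complex.I * ((inner ℝ x ξ : ℝ) : ℂ))) * g x) η at this
  rw [← SchwartzMap.fourierInv_coe, hinv] at this
  calc fourierHat (fun x => χ x * g x) ξ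
      = ∫ x, χ x • (Complex.exp (-(Complex.I * ((inner ℝ x ξ : ℝ) : ℂ))) * g x) := by
        rw [fourierHat]
        congr 1 with x
        rw [smul_eq_mul]
        ring
    _ = _ := this
    _ = _ := by
        congr 1 with η
        rw [smul_eq_mul, Real.fourierInv_eq', fourierHat]
        congr 2 with x
        rw [smul_eq_mul, ← mul_assoc, ← Complex.exp_add, inner_sub_right, inner_smul_right]
        congr 2
        push_cast
        ring

open SchwartzMap FourierTransform in
-- The transform of `χ g` is a convolution with a Schwartz function. Its integral over the line `ℝp`
-- is bounded by pairing, offset by offset, line integrals of `𝓕 χ` with line integrals of `ĝ`; both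
-- are square integrable in the offset, so Cauchy–Schwarz applies.
theorem integrable_fourierHat_schwartz_mul {p : Plane} (hp : p 0 ^ 2 + p 1 ^ 2 = 1)
    (χ : 𝓢(Plane, ℂ)) {g : Plane → ℂ} (hg : Integrable g) {s : ℝ} (hs : 1 / 2 < s)
    (hsob : HasSobolevOrder g s) :
    Integrable fun τ : ℝ => fourierHat (fun x => χ x * g x) (τ • p) := by
  let X : 𝓢(Plane, ℂ) := 𝓕 χ
  have hgc := continuous_fourierHat hg
  have hχg : Integrable fun x => χ x * g x := by
    obtain ⟨C, -, hC⟩ := χ.decay 0 0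
    refine hg.bdd_mul (c := C) χ.continuous.aestronglyMeasurable
      (Filter.Eventually.of_forall fun x => ?_)
    simpa using hC x
  refine ⟨((continuous_fourierHat hχg).comp (by fun_prop)).aestronglyMeasurable, ?_⟩
  rw [hasFiniteIntegral_iff_enorm]
  let H : ℝ × ℝ → ℝ≥0∞ := fun z => ‖fourierHat g (rotation p z)‖ₑ
  have hH : Measurable H := (hgc.comp (continuous_rotation p)).enorm.measurable
  have hHfin : ∫⁻ v : ℝ, (∫⁻ t : ℝ, H (t, v)) ^ 2 < ∞ := by
    refine lintegral_sq_lintegral_lt_top hH hs ?_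
    unfold HasSobolevOrder at hsob
    rw [← (measurePreserving_rotation hp).lintegral_comp_emb
      (measurableEmbedding_rotation hp)] at hsob
    convert hsob using 3 with z
    rw [norm_rotation_sq hp, ENNReal.ofReal_mul (by positivity),
      ENNReal.ofReal_pow (norm_nonneg _), ofReal_norm]
  let Y : ℝ × ℝ → ℝ≥0∞ := fun z => ‖X (rotation p z)‖ₑ
  have hY : Measurable Y := (X.continuous.comp (continuous_rotation p)).enorm.measurable
  have hYfin : ∫⁻ v : ℝ, (∫⁻ t : ℝ, Y (t, v)) ^ 2 < ∞ := lintegral_sq_lintegral_schwartz_lt_top hp X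
  have hπ : -(2 * Real.pi) ≠ 0 := by simp [Real.pi_ne_zero]
  have hG : Measurable fun v : ℝ => ∫⁻ t : ℝ, H (t, v) := hH.lintegral_prod_left'
  have hK : Measurable fun v : ℝ => ∫⁻ t : ℝ, Y (t, v) := hY.lintegral_prod_left'
  have hGs : ∫⁻ v : ℝ, (∫⁻ t : ℝ, H (t, -(2 * Real.pi) * v)) ^ 2 < ∞ := by
    rw [lintegral_comp_mul_left (F := fun v => (∫⁻ t : ℝ, H (t, v)) ^ 2) (hG.pow_const 2) hπ]
    exact ENNReal.mul_lt_top ENNReal.ofReal_lt_top hHfin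
  have hbound : ∀ τ : ℝ, ‖fourierHat (fun x => χ x * g x) (τ • p)‖ₑ ≤
      ∫⁻ z : ℝ × ℝ, Y z * H (τ - 2 * Real.pi * z.1, -(2 * Real.pi) * z.2) := by
    intro τ
    rw [fourierHat_schwartz_mul χ hg]
    refine (enorm_integral_le_lintegral_enorm _).trans_eq ?_
    rw [← (measurePreserving_rotation hp).lintegral_comp_emb (measurableEmbedding_rotation hp)]
    congr 1 with z
    rw [enorm_mul]
    have : τ • p - (2 * Real.pi) • rotation p z =
        rotation p (τ - 2 * Real.pi * z.1, -(2 * Real.pi) * z.2) := by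
      rw [← rotation_fst, ← rotation_smul, ← rotation_sub]
      congr 1
      ext <;> simp
    rw [this]
  have hm3 : Measurable fun w : ℝ × (ℝ × ℝ) =>
      Y w.2 * H (w.1 - 2 * Real.pi * w.2.1, -(2 * Real.pi) * w.2.2) := by
    refine (hY.comp measurable_snd).mul (hH.comp ?_)
    fun_prop
  have hm2 : Measurable fun z : ℝ × ℝ => Y z * ∫⁻ t : ℝ, H (t, -(2 * Real.pi) * z.2) :=
    hY.mul (hG.comp (measurable_snd.const_mul _))
  -- After exchanging the integrals, translation invariance in `τ` removes the coordinate along `p`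
  -- from the factor `H`; only the offset `-2πv` remains.
  have hle : ∫⁻ τ : ℝ, ‖fourierHat (fun x => χ x * g x) (τ • p)‖ₑ ≤
      ∫⁻ v : ℝ, (∫⁻ t : ℝ, Y (t, v)) * ∫⁻ t : ℝ, H (t, -(2 * Real.pi) * v) := by
    calc ∫⁻ τ : ℝ, ‖fourierHat (fun x => χ x * g x) (τ • p)‖ₑ
        ≤ ∫⁻ τ : ℝ, ∫⁻ z : ℝ × ℝ, Y z * H (τ - 2 * Real.pi * z.1, -(2 * Real.pi) * z.2) :=
          lintegral_mono hbound
      _ = ∫⁻ z : ℝ × ℝ, ∫⁻ τ : ℝ, Y z * H (τ - 2 * Real.pi * z.1, -(2 * Real.pi) * z.2) :=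
          lintegral_lintegral_swap hm3.aemeasurable
      _ = ∫⁻ z : ℝ × ℝ, Y z * ∫⁻ t : ℝ, H (t, -(2 * Real.pi) * z.2) := by
          congr 1 with z
          rw [lintegral_const_mul (Y z) (by fun_prop : Measurable fun τ : ℝ =>
              H (τ - 2 * Real.pi * z.1, -(2 * Real.pi) * z.2)),
            lintegral_sub_right_eq_self (fun t => H (t, -(2 * Real.pi) * z.2))]
      _ = ∫⁻ v : ℝ, ∫⁻ u : ℝ, Y (u, v) * ∫⁻ t : ℝ, H (t, -(2 * Real.pi) * v) := by
          rw [Measure.volume_eq_prod, lintegral_prod_symm' _ hm2]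
      _ = _ := by
          congr 1 with v
          rw [lintegral_mul_const _ (by fun_prop : Measurable fun u : ℝ => Y (u, v))]
  refine hle.trans_lt ?_
  have hcs := sq_lintegral_mul_le (μ := volume) hK (hG.comp (measurable_const_mul (-(2 * Real.pi))))
  have := hcs.trans_lt (ENNReal.mul_lt_top hYfin hGs)
  by_contra htop
  rw [not_lt, top_le_iff] at htop
  simp only [Function.comp_apply] at this
  rw [htop] at this
  simp at this

end SobolevSlice

/-! ### Supports and local finiteness of sums of shifts -/

section Support

theorem isCompact_rectangle (lo hi : Fin 2 → ℝ) : IsCompact (rectangle lo hi) := by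
  have h : rectangle lo hi = WithLp.toLp 2 '' Set.Icc lo hi := by
    ext x
    constructor
    · intro hx
      exact ⟨WithLp.ofLp x, ⟨fun i => (hx i).1, fun i => (hx i).2⟩, rfl⟩
    · rintro ⟨y, hy, rfl⟩ i
      exact ⟨hy.1 i, hy.2 i⟩
  rw [h]
  exact isCompact_Icc.image (PiLp.continuous_toLp 2 _)

theorem measurableSet_rectangle (lo hi : Fin 2 → ℝ) : MeasurableSet (rectangle lo hi) :=
  (isCompact_rectangle lo hi).measurableSet

theorem SupportedIn.ae_eq_indicator {f : L2Plane} {S : Set Plane} (h : SupportedIn f S) :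
    f =ᵐ[volume] S.indicator f := by
  filter_upwards [h] with x hx
  by_cases hxS : x ∈ S
  · rw [Set.indicator_of_mem hxS]
  · rw [Set.indicator_of_notMem hxS, hx hxS]

theorem SupportedIn.integrable {f : L2Plane} {lo hi : Fin 2 → ℝ}
    (h : SupportedIn f (rectangle lo hi)) : Integrable f := by
  refine Integrable.congr ?_ h.ae_eq_indicator.symm
  rw [integrable_indicator_iff (measurableSet_rectangle lo hi)]
  have : IsFiniteMeasure ((volume : Measure Plane).restrict (rectangle lo hi)) :=
    isFiniteMeasure_restrict.2 (isCompact_rectangle lo hi).measure_ne_top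
  exact ((Lp.memLp f).restrict _).integrable (by norm_num)

@[simp]
theorem latticePoint_apply (k : Fin 2 → ℤ) (i : Fin 2) : latticePoint k i = k i := rfl

theorem latticePoint_sub (k l : Fin 2 → ℤ) :
    latticePoint (k - l) = latticePoint k - latticePoint l := by
  ext i
  simp

theorem latticePoint_injective : Function.Injective latticePoint := by
  intro k l h
  funext i
  have : latticePoint k i = latticePoint l i := by rw [h]
  simpa using this

theorem mem_indexSet_of_mem_rectangle {N M a b : Fin 2 → ℝ} {x y : Plane} {k : Fin 2 → ℤ}
    (hx : x ∈ rectangle a b) (hy : y ∈ rectangle N M) (h : x = y + latticePoint k) :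
    k ∈ indexSet N M a b := by
  rw [indexSet, Finset.mem_Icc]
  have hi : ∀ i, x i = y i + k i := fun i => by rw [h]; simp
  refine ⟨fun i => Int.ceil_le.2 ?_, fun i => Int.le_floor.2 ?_⟩
  · linarith [hi i, (hx i).1, (hy i).2]
  · linarith [hi i, (hx i).2, (hy i).1]

/-- On a rectangle only finitely many shifts contribute to a sum of shifts. -/
theorem ae_eq_sum_of_hasSum {φ f : L2Plane} {N M : Fin 2 → ℝ}
    (hsupp : SupportedIn φ (rectangle N M)) {c : (Fin 2 → ℤ) → ℂ}
    (hf : HasSum (fun k => c k • shift φ k) f) (a b : Fin 2 → ℝ) :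
    ∀ᵐ x : Plane, x ∈ rectangle a b →
      f x = ∑ k ∈ indexSet N M a b, c k * φ (x - latticePoint k) := by
  -- Restriction to the rectangle is continuous and linear, so it commutes with the `L²` sum, and it
  -- kills every shift outside the index set.
  let T := LpToLpRestrictCLM Plane ℂ ℂ (volume : Measure Plane) 2 (rectangle a b)
  have hT : ∀ h : L2Plane, T h =ᵐ[volume.restrict (rectangle a b)] h :=
    fun h => LpToLpRestrictCLM_coeFn ℂ _ h
  have hzero : ∀ k ∉ indexSet N M a b, T (c k • shift φ k) = 0 := by
    intro k hk
    rw [map_smul, Lp.eq_zero_iff_ae_eq_zero (f := c k • T (shift φ k))]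
    have h1 : ∀ᵐ x : Plane, x - latticePoint k ∉ rectangle N M → φ (x - latticePoint k) = 0 :=
      (measurePreserving_sub_right volume (latticePoint k)).quasiMeasurePreserving.ae hsupp
    have h2 : ∀ᵐ x ∂(volume.restrict (rectangle a b)), shift φ k x = 0 := by
      rw [ae_restrict_iff' (measurableSet_rectangle a b)]
      filter_upwards [h1, shift_ae φ k] with x hx1 hx2 hx
      rw [hx2]
      refine hx1 fun hmem => hk (mem_indexSet_of_mem_rectangle hx hmem ?_)
      rw [sub_add_cancel]
    filter_upwards [Lp.coeFn_smul (c k) (T (shift φ k)), hT (shift φ k), h2] with x h3 h4 h5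
    rw [h3, Pi.smul_apply, h4, h5, smul_zero]
    rfl
  have hTf : T f = T (∑ k ∈ indexSet N M a b, c k • shift φ k) := by
    have h1 := T.hasSum hf
    have h2 := hasSum_sum_of_ne_finset_zero (L := SummationFilter.unconditional _)
      (f := fun k => T (c k • shift φ k)) hzero
    rw [map_sum]
    exact h1.unique h2
  have hfin : ∀ᵐ x ∂(volume.restrict (rectangle a b)),
      f x = (∑ k ∈ indexSet N M a b, c k • shift φ k : L2Plane) x := by
    filter_upwards [hT f, hT (∑ k ∈ indexSet N M a b, c k • shift φ k)] with x h1 h2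
    rw [← h1, ← h2, hTf]
  rw [ae_restrict_iff' (measurableSet_rectangle a b)] at hfin
  have hshift : ∀ᵐ x : Plane, ∀ k, (c k • shift φ k : L2Plane) x = c k * φ (x - latticePoint k) := by
    rw [ae_all_iff]
    intro k
    filter_upwards [Lp.coeFn_smul (c k) (shift φ k), shift_ae φ k] with x h1 h2
    rw [h1, Pi.smul_apply, h2, smul_eq_mul]
  have hsum : ∀ᵐ x : Plane, (∑ k ∈ indexSet N M a b, c k • shift φ k : L2Plane) x =
      ∑ k ∈ indexSet N M a b, (c k • shift φ k : L2Plane) x := by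
    filter_upwards [Lp.coeFn_finsetSum (indexSet N M a b) fun k => c k • shift φ k] with x hx
    rw [hx, Finset.sum_apply]
  filter_upwards [hfin, hshift, hsum] with x h1 h2 h3 hx
  rw [h1 hx, h3]
  exact Finset.sum_congr rfl fun k _ => h2 k

end Support

/-! ### Continuous versions of Radon transforms -/

section ContinuousVersion

open SchwartzMap in
theorem exists_schwartz_eq_one (a b : Fin 2 → ℝ) :
    ∃ (χ : 𝓢(Plane, ℂ)) (a' b' : Fin 2 → ℝ), (∀ x ∈ rectangle a b, χ x = 1) ∧
      ∀ x ∉ rectangle a' b', χ x = 0 := by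
  obtain ⟨r, hr⟩ := (isCompact_rectangle a b).isBounded.subset_closedBall (0 : Plane)
  let B : ContDiffBump (0 : Plane) := ⟨max r 1, max r 1 + 1, by positivity, by linarith⟩
  have hs : HasCompactSupport fun x => (B x : ℂ) :=
    B.hasCompactSupport.comp_left (g := fun r : ℝ => (r : ℂ)) Complex.ofReal_zero
  have hd : ContDiff ℝ ((⊤ : ℕ∞) : WithTop ℕ∞) fun x => (B x : ℂ) :=
    Complex.ofRealCLM.contDiff.comp B.contDiff
  refine ⟨hs.toSchwartzMap hd, fun _ => -(max r 1 + 1), fun _ => max r 1 + 1, ?_, ?_⟩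
  · intro x hx
    have : B x = 1 := B.one_of_mem_closedBall
      (Metric.closedBall_subset_closedBall (le_max_left _ _) (hr hx))
    simp [this]
  · intro x hx
    have : B x = 0 := by
      rw [← Function.notMem_support, B.support_eq]
      intro hmem
      refine hx fun i => abs_le.1 ?_
      have h1 : ‖x‖ < max r 1 + 1 := by simpa using hmem
      exact (PiLp.norm_apply_le x i).trans h1.le
    simp [this]

/-- A cutoff equal to `1` on the support of `f` does not change `f`, while on the larger rectangle
`a'`, `b'` containing the support of the cutoff only finitely many shifts matter. This makes `f` a
finite sum even when its coefficient sequence is infinite. -/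
theorem exists_isContinuousRadon {φ f : L2Plane} {N M a b : Fin 2 → ℝ}
    (hsupp : SupportedIn φ (rectangle N M)) {s : ℝ} (hs : 1 / 2 < s) (hsob : HasSobolevOrder φ s)
    {c : (Fin 2 → ℤ) → ℂ} (hf : HasSum (fun k => c k • shift φ k) f)
    (hfs : SupportedIn f (rectangle a b)) {p : Plane} (hp : p 0 ^ 2 + p 1 ^ 2 = 1) :
    ∃ g, IsContinuousRadon p f g := by
  obtain ⟨χ, a', b', h1, h0⟩ := exists_schwartz_eq_one a b
  have hφi : ∀ k, Integrable fun x => φ (x - latticePoint k) :=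
    fun k => hsupp.integrable.comp_sub_right _
  have hχ : ∀ k, Integrable fun x => χ x * φ (x - latticePoint k) := by
    intro k
    obtain ⟨C, -, hC⟩ := χ.decay 0 0
    refine (hφi k).bdd_mul (c := C) χ.continuous.aestronglyMeasurable
      (Filter.Eventually.of_forall fun x => ?_)
    simpa using hC x
  have hrep : f =ᵐ[volume] fun x =>
      ∑ k ∈ indexSet N M a' b', c k * (χ x * φ (x - latticePoint k)) := by
    filter_upwards [ae_eq_sum_of_hasSum hsupp hf a' b', hfs] with x hx hx2
    have hfx : f x = χ x * f x := by
      by_cases hmem : x ∈ rectangle a b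
      · rw [h1 x hmem, one_mul]
      · rw [hx2 hmem, mul_zero]
    by_cases hmem : x ∈ rectangle a' b'
    · rw [hfx, hx hmem, Finset.mul_sum]
      exact Finset.sum_congr rfl fun k _ => by ring
    · rw [hfx, h0 x hmem]
      simp
  refine exists_continuous_ae_eq_radon hp hfs.integrable ?_
  rw [fourierHat_congr hrep]
  have hsum : ∀ τ : ℝ, fourierHat (fun x =>
      ∑ k ∈ indexSet N M a' b', c k * (χ x * φ (x - latticePoint k))) (τ • p) =
      ∑ k ∈ indexSet N M a' b', c k * fourierHat (fun x => χ x * φ (x - latticePoint k)) (τ • p) := by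
    intro τ
    rw [fourierHat_sum _ _ fun k _ => (hχ k).const_mul _]
    exact Finset.sum_congr rfl fun k _ => fourierHat_const_mul _ _ _
  simp only [hsum]
  exact integrable_finsetSum _ fun k _ => (integrable_fourierHat_schwartz_mul hp χ (hφi k) hs
    (hasSobolevOrder_comp_sub hsob _)).const_mul _

theorem IsContinuousRadon.unique {p : Plane} {f : L2Plane} {g g' : ℝ → ℂ}
    (h : IsContinuousRadon p f g) (h' : IsContinuousRadon p f g') : g = g' :=
  (h.1.ae_eq_iff_eq volume h'.1).1 (h.2.trans h'.2.symm)

end ContinuousVersion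

/-! ### Linear independence of exponentials -/

section Independence

/-- Exponentials with distinct frequencies are linearly independent on every nonempty open set. -/
theorem eq_zero_of_sum_exp_eq_zero {ι : Type*} {U : Set ℝ} (hU : IsOpen U) (hne : U.Nonempty)
    (s : Finset ι) : ∀ (ω : ι → ℝ) (d : ι → ℂ), Set.InjOn ω s →
      (∀ τ ∈ U, ∑ j ∈ s, d j * Complex.exp (Complex.I * ((τ * ω j : ℝ) : ℂ)) = 0) →
      ∀ j ∈ s, d j = 0 := by
  classical
  induction s using Finset.induction_on with
  | empty => simp
  | insert a s ha ih =>
    intro ω d hinj h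
    -- Dividing by the exponential of frequency `ω a` makes its term constant. Differentiating on
    -- the open set `U` removes it and multiplies each remaining coefficient by `i (ω j - ω a)`,
    -- which is nonzero.
    have h1 : ∀ τ ∈ U, d a + ∑ j ∈ s, d j * Complex.exp (Complex.I * ((τ * (ω j - ω a) : ℝ) : ℂ)) =
        0 := by
      intro τ hτ
      have h2 := h τ hτ
      rw [Finset.sum_insert ha] at h2
      have h3 := congrArg (fun z => Complex.exp (-(Complex.I * ((τ * ω a : ℝ) : ℂ))) * z) h2
      simp only [mul_zero, mul_add, Finset.mul_sum] at h3
      rw [← h3]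
      congr 1
      · rw [mul_left_comm, ← Complex.exp_add, neg_add_cancel, Complex.exp_zero, mul_one]
      · refine Finset.sum_congr rfl fun j _ => ?_
        rw [mul_left_comm, ← Complex.exp_add]
        congr 2
        push_cast
        ring
    have hder : ∀ τ : ℝ, HasDerivAt
        (fun τ : ℝ => d a + ∑ j ∈ s, d j * Complex.exp (Complex.I * ((τ * (ω j - ω a) : ℝ) : ℂ)))
        (∑ j ∈ s, d j * (Complex.exp (Complex.I * ((τ * (ω j - ω a) : ℝ) : ℂ)) *
          (Complex.I * ((ω j - ω a : ℝ) : ℂ)))) τ := by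
      intro τ
      refine (HasDerivAt.fun_sum fun j _ => HasDerivAt.const_mul (d j) ?_).const_add (d a)
      refine HasDerivAt.cexp (HasDerivAt.const_mul Complex.I ?_)
      exact (hasDerivAt_mul_const (ω j - ω a)).ofReal_comp
    have h4 : ∀ τ ∈ U, ∑ j ∈ s, (d j * (Complex.I * ((ω j - ω a : ℝ) : ℂ))) *
        Complex.exp (Complex.I * ((τ * (ω j - ω a) : ℝ) : ℂ)) = 0 := by
      intro τ hτ
      have hev : (fun τ : ℝ => d a + ∑ j ∈ s, d j *
          Complex.exp (Complex.I * ((τ * (ω j - ω a) : ℝ) : ℂ))) =ᶠ[nhds τ] fun _ => 0 :=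
        Filter.eventuallyEq_of_mem (hU.mem_nhds hτ) h1
      have h5 := ((hder τ).congr_of_eventuallyEq hev.symm).unique (hasDerivAt_const τ 0)
      rw [← h5]
      exact Finset.sum_congr rfl fun j _ => by ring
    have hs : ∀ j ∈ s, d j = 0 := by
      intro j hj
      have h6 := ih (fun j => ω j - ω a) (fun j => d j * (Complex.I * ((ω j - ω a : ℝ) : ℂ)))
        (fun x hx y hy hxy => hinj (Finset.mem_insert_of_mem hx) (Finset.mem_insert_of_mem hy)
          (by simpa using hxy)) h4 j hj
      have hne' : ω j - ω a ≠ 0 := by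
        intro h7
        have h8 := hinj (Finset.mem_insert_of_mem hj) (Finset.mem_insert_self a s)
          (sub_eq_zero.1 h7)
        exact ha (h8 ▸ hj)
      have h9 : (Complex.I * ((ω j - ω a : ℝ) : ℂ)) ≠ 0 :=
        mul_ne_zero Complex.I_ne_zero (Complex.ofReal_ne_zero.2 hne')
      exact (mul_eq_zero.1 h6).resolve_right h9
    intro j hj
    rcases Finset.mem_insert.1 hj with rfl | hj
    · obtain ⟨τ, hτ⟩ := hne
      have := h1 τ hτ
      rwa [Finset.sum_eq_zero fun j hj => by rw [hs j hj, zero_mul], add_zero] at this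
    · exact hs j hj

end Independence

/-! ### The exchange identity and injectivity of the Radon transform -/

section Exchange

/-- The lattice points that translate `x` into the rectangle. -/
noncomputable def translatesInto (lo hi : Fin 2 → ℝ) (x : Plane) : Finset (Fin 2 → ℤ) :=
  Finset.Icc (fun i => ⌈lo i - x i⌉) (fun i => ⌊hi i - x i⌋)

theorem mem_translatesInto {lo hi : Fin 2 → ℝ} {x : Plane} {k : Fin 2 → ℤ} :
    k ∈ translatesInto lo hi x ↔ x + latticePoint k ∈ rectangle lo hi := by
  simp only [translatesInto, Finset.mem_Icc, Pi.le_def, Int.ceil_le, Int.le_floor, rectangle,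
    Set.mem_ofPred_eq, PiLp.add_apply, latticePoint_apply, ← forall_and]
  refine forall_congr' fun i => ?_
  constructor <;> rintro ⟨h1, h2⟩ <;> constructor <;> linarith

theorem finite_setOf_add_latticePoint_mem (lo hi : Fin 2 → ℝ) (x : Plane) :
    {k | x + latticePoint k ∈ rectangle lo hi}.Finite :=
  (translatesInto lo hi x).finite_toSet.subset fun _ hk => mem_translatesInto.2 hk

theorem finite_setOf_sub_latticePoint_mem (lo hi : Fin 2 → ℝ) (x : Plane) :
    {k | x - latticePoint k ∈ rectangle lo hi}.Finite := by
  have h := (finite_setOf_add_latticePoint_mem lo hi x).image Neg.neg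
  refine h.subset fun k hk => ⟨-k, ?_, neg_neg k⟩
  have : latticePoint (-k) = -latticePoint k := by ext i; simp
  simpa [this, ← sub_eq_add_neg] using hk

/-- If `F` is a sum of shifts of `Φ`, then the `Φ`-samples of `F` and the `F`-samples of `Φ` on two
cosets of the lattice agree after convolution. -/
theorem tsum_mul_eq_tsum_mul {Φ F : Plane → ℂ} {N M : Fin 2 → ℝ}
    (hΦ : ∀ x ∉ rectangle N M, Φ x = 0) {c : (Fin 2 → ℤ) → ℂ} {x y : Plane}
    (hx : ∀ j, F (x + latticePoint j) = ∑' k, c k * Φ (x + latticePoint j - latticePoint k))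
    (hy : ∀ l, F (y - latticePoint l) = ∑' k, c k * Φ (y - latticePoint l - latticePoint k)) :
    ∑' l, Φ (x + latticePoint l) * F (y - latticePoint l) =
      ∑' j, F (x + latticePoint j) * Φ (y - latticePoint j) := by
  -- Both sides are iterated sums of `A`, which has finite support because `Φ` has bounded support.
  -- The substitution `l = j - k` turns one into the other.
  let A : (Fin 2 → ℤ) × (Fin 2 → ℤ) → ℂ := fun q =>
    Φ (x + latticePoint q.1) * (c q.2 * Φ (y - latticePoint q.1 - latticePoint q.2))
  have hA : Function.support A ⊆ (⋃ l ∈ {l | x + latticePoint l ∈ rectangle N M},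
      (fun k => (l, k)) '' {k | y - latticePoint l - latticePoint k ∈ rectangle N M}) := by
    rintro ⟨l, k⟩ hq
    simp only [A, Function.mem_support, ne_eq, mul_eq_zero, not_or] at hq
    simp only [Set.mem_iUnion]
    refine ⟨l, ?_, k, ?_, rfl⟩
    · by_contra h
      exact hq.1 (hΦ _ h)
    · by_contra h
      exact hq.2.2 (hΦ _ h)
  have hAfin : (Function.support A).Finite :=
    ((finite_setOf_add_latticePoint_mem N M x).biUnion fun l _ =>
      (finite_setOf_sub_latticePoint_mem N M (y - latticePoint l)).image _).subset hA
  have hAs : Summable A := summable_of_hasFiniteSupport hAfin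
  let e : (Fin 2 → ℤ) × (Fin 2 → ℤ) ≃ (Fin 2 → ℤ) × (Fin 2 → ℤ) :=
    { toFun := fun q => (q.1 - q.2, q.2)
      invFun := fun q => (q.1 + q.2, q.2)
      left_inv := fun q => by simp
      right_inv := fun q => by simp }
  have hAe : Summable (A ∘ e) := e.summable_iff.2 hAs
  calc ∑' l, Φ (x + latticePoint l) * F (y - latticePoint l)
      = ∑' l, ∑' k, A (l, k) := by
        congr 1 with l
        rw [hy l, ← tsum_mul_left]
    _ = ∑' q, A q := hAs.tsum_prod.symm
    _ = ∑' q, (A ∘ e) q := (e.tsum_eq A).symm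
    _ = ∑' j, ∑' k, (A ∘ e) (j, k) := hAe.tsum_prod
    _ = _ := by
        congr 1 with j
        rw [hx j, ← tsum_mul_right]
        congr 1 with k
        simp only [A, e, Function.comp_apply, Equiv.coe_fn_mk, latticePoint_sub]
        rw [show y - (latticePoint j - latticePoint k) - latticePoint k = y - latticePoint j by abel,
          show x + (latticePoint j - latticePoint k) = x + latticePoint j - latticePoint k by abel]
        ring

/-- For the truncated representative the series has finitely many nonzero terms at every point, so
the `L²` sum can be read pointwise; the plane is exhausted by countably many squares to keep one
null set. -/
theorem ae_eq_tsum_of_hasSum {φ f : L2Plane} {N M : Fin 2 → ℝ}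
    (hsupp : SupportedIn φ (rectangle N M)) {c : (Fin 2 → ℤ) → ℂ}
    (hf : HasSum (fun k => c k • shift φ k) f) :
    ∀ᵐ x : Plane, f x = ∑' k, c k * (rectangle N M).indicator φ (x - latticePoint k) := by
  have h1 : ∀ᵐ x : Plane, ∀ n : ℕ, x ∈ rectangle (fun _ => -(n : ℝ)) (fun _ => (n : ℝ)) →
      f x = ∑ k ∈ indexSet N M (fun _ => -(n : ℝ)) (fun _ => (n : ℝ)),
        c k * φ (x - latticePoint k) :=
    ae_all_iff.2 fun n => ae_eq_sum_of_hasSum hsupp hf _ _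
  have h2 : ∀ᵐ x : Plane, ∀ k, φ (x - latticePoint k) =
      (rectangle N M).indicator φ (x - latticePoint k) :=
    ae_all_iff.2 fun k => (measurePreserving_sub_right volume
      (latticePoint k)).quasiMeasurePreserving.ae hsupp.ae_eq_indicator
  filter_upwards [h1, h2] with x hx hx2
  obtain ⟨n, hn⟩ := exists_nat_ge ‖x‖
  have hmem : x ∈ rectangle (fun _ => -(n : ℝ)) (fun _ => (n : ℝ)) :=
    fun i => abs_le.1 ((PiLp.norm_apply_le x i).trans hn)
  rw [hx n hmem, tsum_eq_sum (s := indexSet N M (fun _ => -(n : ℝ)) (fun _ => (n : ℝ)))]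
  · exact Finset.sum_congr rfl fun k _ => by rw [hx2 k]
  · intro k hk
    rw [Set.indicator_of_notMem, mul_zero]
    intro h
    exact hk (mem_indexSet_of_mem_rectangle hmem h (sub_add_cancel _ _).symm)

/-- A sum of shifts with support in a rectangle is zero if its Radon transform vanishes, provided
that the direction separates the index set. -/
theorem eq_zero_of_radon_ae_eq_zero {φ f : L2Plane} {N M a b : Fin 2 → ℝ}
    (hsupp : SupportedIn φ (rectangle N M)) {c : (Fin 2 → ℤ) → ℂ}
    (hf : HasSum (fun k => c k • shift φ k) f) (hfs : SupportedIn f (rectangle a b))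
    {p : Plane} (hp : p 0 ^ 2 + p 1 ^ 2 = 1) {t₀ : ℝ} (ht₀ : fourierHat φ (t₀ • p) ≠ 0)
    (hinj : Set.InjOn (fun k => (inner ℝ (latticePoint k) p : ℝ)) (indexSet N M a b))
    (hR : radon p f =ᵐ[volume] 0) : f = 0 := by
  have hφi := hsupp.integrable
  have hfi := hfs.integrable
  -- Representatives vanishing everywhere off the rectangles are needed because the exchange
  -- identity is evaluated at individual lattice translates of a fixed point.
  set Φ : Plane → ℂ := (rectangle N M).indicator φ with hΦdef
  set F : Plane → ℂ := (rectangle a b).indicator f with hFdef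
  have hΦ0 : ∀ x ∉ rectangle N M, Φ x = 0 := fun x hx => Set.indicator_of_notMem hx _
  have hF0 : ∀ x ∉ rectangle a b, F x = 0 := fun x hx => Set.indicator_of_notMem hx _
  have hφΦ : φ =ᵐ[volume] Φ := hsupp.ae_eq_indicator
  have hfF : f =ᵐ[volume] F := hfs.ae_eq_indicator
  have hΦi : Integrable Φ := hφi.congr hφΦ
  have hFi : Integrable F := hfi.congr hfF
  have hFhat : ∀ τ : ℝ, fourierHat F (τ • p) = 0 := by
    intro τ
    rw [fourierHat_smul_eq_integral_radon hp hFi]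
    refine integral_eq_zero_of_ae ?_
    filter_upwards [hR, radon_congr hp hfF] with t h1 h2
    rw [← h2, h1]
    simp
  rw [fourierHat_congr hφΦ] at ht₀
  have hUo : IsOpen {τ : ℝ | fourierHat Φ (τ • p) ≠ 0} :=
    isOpen_ne_fun ((continuous_fourierHat hΦi).comp (by fun_prop)) continuous_const
  have hG0 : ∀ᵐ x : Plane, F x = ∑' k, c k * Φ (x - latticePoint k) := by
    filter_upwards [ae_eq_tsum_of_hasSum hsupp hf, hfF] with x h1 h2
    rw [← h2, h1]
  have hG : ∀ᵐ x : Plane, ∀ j, F (x - latticePoint j) =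
      ∑' k, c k * Φ (x - latticePoint j - latticePoint k) :=
    ae_all_iff.2 fun j =>
      (measurePreserving_sub_right volume (latticePoint j)).quasiMeasurePreserving.ae hG0
  have hneg : ∀ j, latticePoint (-j) = -latticePoint j := fun j => by ext i; simp
  -- Here `x` is fixed and the exchange identity is an almost everywhere equality in `y`. Since `x`
  -- lies in the rectangle of `φ`, only `j` in `indexSet N M a b` can bring `x + latticePoint j`
  -- into the rectangle of `f`.
  have hvanish : ∀ x : Plane, (∀ j, F (x + latticePoint j) =
      ∑' k, c k * Φ (x + latticePoint j - latticePoint k)) → x ∈ rectangle N M →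
      ∀ j, F (x + latticePoint j) = 0 := by
    intro x hx hxN
    have hconv : (fun y => ∑ l ∈ translatesInto N M x,
        Φ (x + latticePoint l) * F (y - latticePoint l)) =ᵐ[volume]
        fun y => ∑ j ∈ translatesInto a b x, F (x + latticePoint j) * Φ (y - latticePoint j) := by
      filter_upwards [hG] with y hy
      have h := tsum_mul_eq_tsum_mul hΦ0 hx hy
      rwa [tsum_eq_sum (s := translatesInto N M x) fun l hl => by
          rw [hΦ0 _ fun h => hl (mem_translatesInto.2 h), zero_mul],
        tsum_eq_sum (s := translatesInto a b x) fun l hl => by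
          rw [hF0 _ fun h => hl (mem_translatesInto.2 h), zero_mul]] at h
    have hhat : ∀ τ ∈ {τ : ℝ | fourierHat Φ (τ • p) ≠ 0}, ∑ j ∈ translatesInto a b x,
        F (x + latticePoint j) *
          Complex.exp (Complex.I * ((τ * -(inner ℝ (latticePoint j) p : ℝ) : ℝ) : ℂ)) = 0 := by
      intro τ hτ
      have h := congrFun (fourierHat_congr hconv) (τ • p)
      rw [fourierHat_sum _ _ fun l _ => (hFi.comp_sub_right _).const_mul _,
        fourierHat_sum _ _ fun j _ => (hΦi.comp_sub_right _).const_mul _] at h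
      simp only [fourierHat_const_mul, fourierHat_comp_sub, hFhat, mul_zero,
        Finset.sum_const_zero] at h
      refine (mul_eq_zero.1 ?_).resolve_right hτ
      rw [Finset.sum_mul, h]
      refine Finset.sum_congr rfl fun j _ => ?_
      rw [inner_smul_right, mul_assoc]
      congr 3
      push_cast
      ring
    have hsub : translatesInto a b x ⊆ indexSet N M a b := fun j hj =>
      mem_indexSet_of_mem_rectangle (mem_translatesInto.1 hj) hxN rfl
    have hz := eq_zero_of_sum_exp_eq_zero hUo ⟨t₀, ht₀⟩ (translatesInto a b x)
      (fun j => -(inner ℝ (latticePoint j) p : ℝ)) (fun j => F (x + latticePoint j))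
      (fun j hj k hk hjk => hinj (hsub hj) (hsub hk) (neg_injective hjk)) hhat
    intro j
    by_cases hj : x + latticePoint j ∈ rectangle a b
    · exact hz j (mem_translatesInto.2 hj)
    · exact hF0 _ hj
  rw [Lp.eq_zero_iff_ae_eq_zero]
  filter_upwards [hG0, hG, hfF] with x h0 h1 h2
  rw [h2, Pi.zero_apply]
  -- Almost every point either has a lattice translate in the rectangle of `φ`, where `hvanish`
  -- applies, or lies outside all shifts of it, where every term of the series is zero.
  by_cases hk : ∃ k, x - latticePoint k ∈ rectangle N M
  · obtain ⟨k, hk⟩ := hk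
    have := hvanish (x - latticePoint k) (fun j => ?_) hk k
    · rwa [sub_add_cancel] at this
    · have h3 := h1 (k - j)
      rwa [latticePoint_sub, ← sub_add] at h3
  · push Not at hk
    rw [h0]
    simp [hΦ0 _ (hk _)]

end Exchange

/-! ### Directions and their angles -/

section Directions

theorem norm_cos_sin (θ : ℝ) : ‖(!₂[Real.cos θ, Real.sin θ] : Plane)‖ = 1 := by
  rw [EuclideanSpace.norm_eq]
  simp [Fin.sum_univ_two]

theorem continuous_cos_sin : Continuous fun θ : ℝ => (!₂[Real.cos θ, Real.sin θ] : Plane) := by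
  refine (PiLp.continuous_toLp 2 _).comp (continuous_pi fun i => ?_)
  fin_cases i
  · exact Real.continuous_cos
  · exact Real.continuous_sin

theorem exists_angle (y : Plane) :
    ∃ θ ∈ Set.Ico 0 (2 * Real.pi), y = ‖y‖ • (!₂[Real.cos θ, Real.sin θ] : Plane) := by
  let z : ℂ := ⟨y 0, y 1⟩
  have hz : ‖z‖ = ‖y‖ := by
    rw [EuclideanSpace.norm_eq, Complex.norm_eq_sqrt_sq_add_sq]
    simp [Fin.sum_univ_two, z]
  have hper : ∀ n : ℤ, y = ‖y‖ • (!₂[Real.cos (z.arg - n • (2 * Real.pi)),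
      Real.sin (z.arg - n • (2 * Real.pi))] : Plane) := by
    intro n
    rw [zsmul_eq_mul, Real.cos_sub_int_mul_two_pi, Real.sin_sub_int_mul_two_pi]
    ext i
    fin_cases i
    · simpa [hz, z] using (Complex.norm_mul_cos_arg z).symm
    · simpa [hz, z] using (Complex.norm_mul_sin_arg z).symm
  refine ⟨toIcoMod Real.two_pi_pos 0 z.arg, ?_, hper _⟩
  simpa using toIcoMod_mem_Ico Real.two_pi_pos 0 z.arg

theorem ball_subset_openDisc_maxRadius {g : Plane → ℂ} {x : Plane} {ε : ℝ}
    (h : ∀ y ∈ Metric.ball x ε, g y ≠ 0) : Metric.ball x ε ⊆ openDisc x (maxRadius g x) := by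
  have hmem : ENNReal.ofReal ε ≤ maxRadius g x := by
    refine le_sSup fun y hy => h y ?_
    rwa [openDisc, Set.mem_ofPred_eq, edist_lt_ofReal] at hy
  intro y hy
  exact lt_of_lt_of_le (edist_lt_ofReal.2 hy) hmem

theorem cos_sin_mem_directionSet {S : Set Plane} {r θ : ℝ} (hr : 0 < r)
    (h : r • (!₂[Real.cos θ, Real.sin θ] : Plane) ∈ S) :
    !₂[Real.cos θ, Real.sin θ] ∈ directionSet S := by
  have hnorm : ‖r • (!₂[Real.cos θ, Real.sin θ] : Plane)‖ = r := by
    rw [norm_smul, norm_cos_sin, mul_one, Real.norm_of_nonneg hr.le]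
  refine ⟨⟨θ, rfl⟩, _, h, ?_, ?_⟩
  · rw [← norm_pos_iff, hnorm]
    exact hr
  · rw [hnorm]

/-- The directions of the discs without zeros of a continuous function have positive measure. -/
theorem volume_angleSet_flagDirections_pos {g : Plane → ℂ} (hg : Continuous g) {x : Plane}
    (hx : g x ≠ 0) : 0 < volume (angleSet (flagDirections g)) := by
  obtain ⟨ε, hε, hball⟩ := Metric.isOpen_iff.1 (isOpen_ne_fun hg continuous_const) x hx
  -- The centre may be the origin, which has no direction; a nearby point replaces it.
  obtain ⟨y, hy, hy0⟩ : ∃ y ∈ Metric.ball x ε, y ≠ 0 := by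
    by_cases h : x = 0
    · refine ⟨(ε / 2) • !₂[Real.cos 0, Real.sin 0], ?_, ?_⟩
      · rw [h, mem_ball_zero_iff, norm_smul, norm_cos_sin, Real.norm_of_nonneg (by positivity)]
        linarith
      · rw [← norm_pos_iff, norm_smul, norm_cos_sin, Real.norm_of_nonneg (by positivity)]
        linarith
    · exact ⟨x, Metric.mem_ball_self hε, h⟩
  obtain ⟨θ, hθ, hyθ⟩ := exists_angle y
  obtain ⟨U, hU, hθU, hUb⟩ : ∃ U : Set ℝ, IsOpen U ∧ θ ∈ U ∧
      ∀ t ∈ U, ‖y‖ • (!₂[Real.cos t, Real.sin t] : Plane) ∈ Metric.ball x ε := by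
    refine ⟨_, Metric.isOpen_ball.preimage (continuous_cos_sin.const_smul ‖y‖), ?_, fun t ht => ht⟩
    rw [hyθ] at hy
    exact hy
  -- The angle may be `0`, whose neighbourhoods leave `[0, 2π)`; they still meet the interior of the
  -- interval in a nonempty open set.
  have hcl : θ ∈ closure (Set.Ioo 0 (2 * Real.pi)) := by
    rw [closure_Ioo Real.two_pi_pos.ne]
    exact Set.Ico_subset_Icc_self hθ
  have hne : (U ∩ Set.Ioo 0 (2 * Real.pi)).Nonempty := mem_closure_iff.1 hcl U hU hθU
  refine lt_of_lt_of_le ((hU.inter isOpen_Ioo).measure_pos volume hne) (measure_mono ?_)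
  rintro t ⟨htU, ht⟩
  exact ⟨Set.Ioo_subset_Ico_self ht, Set.mem_biUnion (x := x) hx
    (cos_sin_mem_directionSet (norm_pos_iff.2 hy0)
      (ball_subset_openDisc_maxRadius hball (hUb t htU)))⟩

/-- In polar form the inner product is `‖z‖ cos(θ - α)`, whose zeros are discrete. -/
theorem countable_setOf_inner_cos_sin_eq_zero {z : Plane} (hz : z ≠ 0) :
    {θ : ℝ | inner ℝ z (!₂[Real.cos θ, Real.sin θ] : Plane) = 0}.Countable := by
  obtain ⟨α, -, hα⟩ := exists_angle z
  refine (Set.countable_range fun n : ℤ => (2 * n + 1) * Real.pi / 2 + α).mono ?_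
  intro θ hθ
  have h : inner ℝ z (!₂[Real.cos θ, Real.sin θ] : Plane) = ‖z‖ * Real.cos (θ - α) := by
    nth_rewrite 1 [hα]
    rw [real_inner_smul_left, Real.cos_sub]
    simp [PiLp.inner_apply, Fin.sum_univ_two]
  rw [Set.mem_ofPred_eq, h] at hθ
  obtain ⟨n, hn⟩ := Real.cos_eq_zero_iff.1
    ((mul_eq_zero.1 hθ).resolve_left (norm_ne_zero_iff.2 hz))
  exact ⟨n, by linarith⟩

theorem countable_angles_directionSet_nullSet (E : Finset (Fin 2 → ℤ)) :
    {θ : ℝ | !₂[Real.cos θ, Real.sin θ] ∈ directionSet (nullSet (differenceSet E))}.Countable := by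
  have h : (⋃ k ∈ E, ⋃ l ∈ E, ⋃ _ : k ≠ l, {θ : ℝ | inner ℝ (latticePoint k - latticePoint l)
      (!₂[Real.cos θ, Real.sin θ] : Plane) = 0}).Countable :=
    E.countable_toSet.biUnion fun k _ => E.countable_toSet.biUnion fun l _ =>
      Set.countable_iUnion fun hkl => countable_setOf_inner_cos_sin_eq_zero
        (sub_ne_zero.2 (latticePoint_injective.ne hkl))
  refine h.mono ?_
  rintro θ ⟨-, y, ⟨hy0, z, ⟨k, hk, l, hl, hkl, rfl⟩, -, hzy⟩, -, hy⟩
  rw [hy, real_inner_smul_right] at hzy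
  simp only [Set.mem_iUnion]
  exact ⟨k, hk, l, hl, hkl, (mul_eq_zero.1 hzy).resolve_left (norm_ne_zero_iff.2 hy0)⟩

theorem sq_add_sq_eq_one_of_eq_cos_sin {p : Plane} (h : ∃ θ : ℝ, p = !₂[Real.cos θ, Real.sin θ]) :
    p 0 ^ 2 + p 1 ^ 2 = 1 := by
  obtain ⟨θ, rfl⟩ := h
  simp

/-- A direction outside the null directions of the differences separates the index set. -/
theorem injOn_inner_of_notMem {E : Finset (Fin 2 → ℤ)} {p : Plane}
    (hp : ∃ θ : ℝ, p = !₂[Real.cos θ, Real.sin θ])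
    (h : p ∉ directionSet (nullSet (differenceSet E))) :
    Set.InjOn (fun k => (inner ℝ (latticePoint k) p : ℝ)) E := by
  intro k hk l hl hkl
  by_contra hne
  have hnorm : ‖p‖ = 1 := by
    obtain ⟨θ, rfl⟩ := hp
    exact norm_cos_sin θ
  have hp0 : p ≠ 0 := by
    rw [← norm_ne_zero_iff, hnorm]
    exact one_ne_zero
  refine h ⟨hp, p, ⟨hp0, _, ⟨k, hk, l, hl, hne, rfl⟩,
    sub_ne_zero.2 (latticePoint_injective.ne hne), ?_⟩, hp0, ?_⟩
  · rw [inner_sub_left, sub_eq_zero]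
    exact hkl
  · rw [hnorm, one_smul]

theorem exists_fourierHat_ne_zero {φ : L2Plane} {N M : Fin 2 → ℝ}
    (hsupp : SupportedIn φ (rectangle N M)) (hφ : φ ≠ 0) : ∃ ξ, fourierHat φ ξ ≠ 0 := by
  by_contra! h
  exact hφ ((Lp.eq_zero_iff_ae_eq_zero).2 (ae_eq_zero_of_fourierHat_eq_zero hsupp.integrable h))

end Directions

/-! ### Sampling points for finite-dimensional families -/

section Sampling

/-- A linear family of functions of dimension at most `n` on an infinite set is determined by its
values at suitable `n` points. -/
theorem exists_finset_card_eq_forall_eq_zero {K V α : Type*} [Field K] [AddCommGroup V]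
    [Module K V] [FiniteDimensional K V] [Infinite α] (T : V →ₗ[K] (α → K)) (n : ℕ) :
    ∀ U : Submodule K V, Module.finrank K U ≤ n →
      ∃ X : Finset α, X.card = n ∧ ∀ u ∈ U, (∀ x ∈ X, T u x = 0) → T u = 0 := by
  classical
  induction n with
  | zero =>
    intro U hU
    refine ⟨∅, rfl, fun u hu _ => ?_⟩
    rw [Submodule.finrank_eq_zero.1 (Nat.le_zero.1 hU), Submodule.mem_bot] at hu
    rw [hu, map_zero]
  | succ n ih =>
    intro U hU
    by_cases h : ∀ u ∈ U, T u = 0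
    · obtain ⟨X, hX⟩ := Infinite.exists_subset_card_eq α (n + 1)
      exact ⟨X, hX, fun u hu _ => h u hu⟩
    · push Not at h
      obtain ⟨u₀, hu₀, hT⟩ := h
      obtain ⟨x₀, hx₀⟩ := Function.ne_iff.1 hT
      -- Vanishing at a point where some member is nonzero cuts out a proper subspace, so each new
      -- point lowers the dimension. The set is later padded, since `x₀` may already be in `X`.
      let U' : Submodule K V := U ⊓ LinearMap.ker (LinearMap.proj x₀ ∘ₗ T)
      have hlt : U' < U := by
        refine lt_of_le_of_ne inf_le_left fun heq => hx₀ ?_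
        have : u₀ ∈ U' := heq ▸ hu₀
        simpa using this.2
      obtain ⟨X, hX, hsep⟩ := ih U' (by
        have := Submodule.finrank_lt_finrank_of_lt hlt
        omega)
      obtain ⟨Y, hY, hYc⟩ := Infinite.exists_superset_card_eq (insert x₀ X) (n + 1)
        ((Finset.card_insert_le _ _).trans (by omega))
      refine ⟨Y, hYc, fun u hu hz => hsep u ⟨hu, ?_⟩ fun x hx =>
        hz x (hY (Finset.mem_insert_of_mem hx))⟩
      simpa using hz x₀ (hY (Finset.mem_insert_self _ _))

end Sampling

/-! ### The space of targets and its dimension -/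

section Targets

/-- The sums of shifts of `φ` with support in the rectangle, without any condition on the
coefficients. -/
def supportedSums (φ : L2Plane) (a b : Fin 2 → ℝ) : Submodule ℂ L2Plane where
  carrier := {f | (∃ c : (Fin 2 → ℤ) → ℂ, HasSum (fun k => c k • shift φ k) f) ∧
    SupportedIn f (rectangle a b)}
  zero_mem' := by
    refine ⟨⟨0, by simp [hasSum_zero]⟩, ?_⟩
    filter_upwards [Lp.coeFn_zero ℂ 2 (volume : Measure Plane)] with x hx _
    rw [hx, Pi.zero_apply]
  add_mem' := by
    rintro f g ⟨⟨c, hc⟩, hf⟩ ⟨⟨d, hd⟩, hg⟩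
    refine ⟨⟨c + d, by simpa only [Pi.add_apply, add_smul] using hc.add hd⟩, ?_⟩
    filter_upwards [Lp.coeFn_add f g, hf, hg] with x h1 h2 h3 hx
    rw [h1, Pi.add_apply, h2 hx, h3 hx, add_zero]
  smul_mem' := by
    rintro r f ⟨⟨c, hc⟩, hf⟩
    refine ⟨⟨r • c, by simpa only [Pi.smul_apply, smul_assoc] using hc.const_smul r⟩, ?_⟩
    filter_upwards [Lp.coeFn_smul r f, hf] with x h1 h2 hx
    rw [h1, Pi.smul_apply, h2 hx, smul_zero]

theorem targets_subset_supportedSums (φ : L2Plane) (a b : Fin 2 → ℝ) :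
    targets φ a b ⊆ supportedSums φ a b :=
  fun _ hf => ⟨⟨hf.1.choose, hf.1.choose_spec.2⟩, hf.2⟩

/-- On the rectangle only the shifts in the index set contribute, and `f` is zero elsewhere. The
generators are truncated shifts, as a shift may itself reach beyond the rectangle. -/
theorem exists_supportedSums_le_span {φ : L2Plane} {N M : Fin 2 → ℝ}
    (hsupp : SupportedIn φ (rectangle N M)) (a b : Fin 2 → ℝ) :
    ∃ v : indexSet N M a b → L2Plane, supportedSums φ a b ≤ Submodule.span ℂ (Set.range v) := by
  obtain ⟨v, hv⟩ : ∃ v : indexSet N M a b → L2Plane,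
      ∀ k, v k =ᵐ[volume] (rectangle a b).indicator (shift φ k) :=
    ⟨fun k => ((Lp.memLp (shift φ k)).indicator (measurableSet_rectangle a b)).toLp,
      fun k => MemLp.coeFn_toLp _⟩
  refine ⟨v, ?_⟩
  rintro f ⟨⟨c, hc⟩, hf⟩
  have hcv : ∀ᵐ x : Plane, ∀ k : indexSet N M a b, (c k • v k : L2Plane) x =
      c k * (rectangle a b).indicator (shift φ k) x := by
    rw [ae_all_iff]
    intro k
    filter_upwards [Lp.coeFn_smul (c k) (v k), hv k] with x h1 h2
    rw [h1, Pi.smul_apply, h2, smul_eq_mul]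
  have hshift : ∀ᵐ x : Plane, ∀ k, shift φ k x = φ (x - latticePoint k) :=
    ae_all_iff.2 fun k => shift_ae φ k
  have hrep : f = ∑ k : indexSet N M a b, c k • v k := by
    refine Lp.ext ?_
    filter_upwards [ae_eq_sum_of_hasSum hsupp hc a b, hf, hcv, hshift,
      Lp.coeFn_finsetSum Finset.univ fun k : indexSet N M a b => c k • v k] with x h1 h2 h3 h4 h5
    rw [h5, Finset.sum_apply, Finset.sum_congr rfl fun k _ => h3 k]
    by_cases hx : x ∈ rectangle a b
    · simp only [Set.indicator_of_mem hx, h4]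
      rw [h1 hx, ← Finset.sum_coe_sort]
    · simp [Set.indicator_of_notMem hx, h2 hx]
  rw [hrep]
  exact Submodule.sum_mem _ fun k _ =>
    Submodule.smul_mem _ _ (Submodule.subset_span (Set.mem_range_self k))

theorem finiteDimensional_supportedSums {φ : L2Plane} {N M : Fin 2 → ℝ}
    (hsupp : SupportedIn φ (rectangle N M)) (a b : Fin 2 → ℝ) :
    FiniteDimensional ℂ (supportedSums φ a b) := by
  obtain ⟨v, hv⟩ := exists_supportedSums_le_span hsupp a b
  have := FiniteDimensional.span_of_finite ℂ (Set.finite_range v)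
  exact Submodule.finiteDimensional_of_le hv

theorem finrank_supportedSums_le {φ : L2Plane} {N M : Fin 2 → ℝ}
    (hsupp : SupportedIn φ (rectangle N M)) (a b : Fin 2 → ℝ) :
    Module.finrank ℂ (supportedSums φ a b) ≤ (indexSet N M a b).card := by
  obtain ⟨v, hv⟩ := exists_supportedSums_le_span hsupp a b
  have := FiniteDimensional.span_of_finite ℂ (Set.finite_range v)
  refine (Submodule.finrank_mono hv).trans ((finrank_range_le_card v).trans_eq ?_)
  simp

theorem IsContinuousRadon.add {p : Plane} (hp : p 0 ^ 2 + p 1 ^ 2 = 1) {f f' : L2Plane}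
    (hf : Integrable f) (hf' : Integrable f') {g g' : ℝ → ℂ} (h : IsContinuousRadon p f g)
    (h' : IsContinuousRadon p f' g') : IsContinuousRadon p (f + f') (g + g') :=
  ⟨h.1.add h'.1, (h.2.add h'.2).trans ((radon_add hp hf hf').symm.trans
    (radon_congr hp (Lp.coeFn_add f f').symm))⟩

theorem IsContinuousRadon.const_smul {p : Plane} (hp : p 0 ^ 2 + p 1 ^ 2 = 1) {f : L2Plane}
    {g : ℝ → ℂ} (h : IsContinuousRadon p f g) (c : ℂ) : IsContinuousRadon p (c • f) (c • g) := by
  refine ⟨h.1.const_smul c, (h.2.const_smul c).trans ?_⟩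
  have h1 : c • radon p f = radon p (c • f) := (radon_const_smul p c f).symm
  rw [h1]
  exact radon_congr hp (Lp.coeFn_smul c f).symm

end Targets

end SingleAngleCT

/-! ### The main theorem -/

theorem theorem4p10 (φ : L2Plane) (N M : Fin 2 → ℝ)
    (hsupp : SupportedIn φ (rectangle N M))
    (hindep : LinearIndependent ℂ (fun k : Fin 2 → ℤ => shift φ k))
    (hsmooth : ((1 / 2 : ℝ) : EReal) < sobolevSmoothness φ)
    (hvanish : ∫ x, φ x = 0)
    (a b : Fin 2 → ℝ) :
    0 < volume (angleSet (flagDirections (fourierHat φ))) ∧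
    (flagDirections (fourierHat φ) \
      directionSet (nullSet (differenceSet (indexSet N M a b)))).Nonempty ∧
    ∀ p ∈ flagDirections (fourierHat φ) \
        directionSet (nullSet (differenceSet (indexSet N M a b))),
      (∀ f ∈ targets φ a b, ∃! g : ℝ → ℂ, IsContinuousRadon p f g) ∧
      ∃ X : Finset ℝ, X.card = (indexSet N M a b).card ∧
        ∀ f₁ ∈ targets φ a b, ∀ f₂ ∈ targets φ a b, ∀ g₁ g₂ : ℝ → ℂ,
          IsContinuousRadon p f₁ g₁ → IsContinuousRadon p f₂ g₂ →
          (∀ x ∈ X, g₁ x = g₂ x) → f₁ = f₂ := by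
  have hφ0 : φ ≠ 0 := by
    intro h
    refine hindep.ne_zero 0 ?_
    rw [h, shift, map_zero]
  obtain ⟨ξ, hξ⟩ := exists_fourierHat_ne_zero hsupp hφ0
  have hpos := volume_angleSet_flagDirections_pos (continuous_fourierHat hsupp.integrable) hξ
  obtain ⟨_, ⟨s, hsob, rfl⟩, hs'⟩ := lt_sSup_iff.1 hsmooth
  have hs : 1 / 2 < s := EReal.coe_lt_coe_iff.1 hs'
  refine ⟨hpos, ?_, ?_⟩
  · have hnull := (countable_angles_directionSet_nullSet (indexSet N M a b)).measure_zero volume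
    obtain ⟨θ, hθ, hθ'⟩ : (angleSet (flagDirections (fourierHat φ)) \ {θ : ℝ |
        !₂[Real.cos θ, Real.sin θ] ∈
          directionSet (nullSet (differenceSet (indexSet N M a b)))}).Nonempty := by
      by_contra h
      rw [Set.not_nonempty_iff_eq_empty, Set.sdiff_eq_empty] at h
      exact hpos.ne' (measure_mono_null h hnull)
    exact ⟨_, hθ.2, hθ'⟩
  · rintro p ⟨hpD, hpN⟩
    simp only [flagDirections, Set.mem_iUnion] at hpD
    obtain ⟨x, hx, hpθ, y, hy, -, hyp⟩ := hpD
    have hp := sq_add_sq_eq_one_of_eq_cos_sin hpθ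
    -- The point `y` is a multiple of `p`, so this is a nonzero value of the transform on the line
    -- `ℝp`.
    have hy0 := ne_zero_of_mem_openDisc_maxRadius _ _ y hy
    rw [hyp] at hy0
    have hinj := injOn_inner_of_notMem hpθ hpN
    have hex : ∀ f : supportedSums φ a b, ∃ g, IsContinuousRadon p f g := fun f =>
      exists_isContinuousRadon hsupp hs hsob f.2.1.choose_spec f.2.2 hp
    have hint : ∀ f : supportedSums φ a b, Integrable (f : L2Plane) := fun f => f.2.2.integrable
    choose G hG using hex
    -- Uniqueness of continuous versions makes the chosen versions depend linearly on `f`.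
    let T : supportedSums φ a b →ₗ[ℂ] (ℝ → ℂ) :=
      { toFun := G
        map_add' := fun f f' =>
          (hG (f + f')).unique ((hG f).add hp (hint f) (hint f') (hG f'))
        map_smul' := fun c f => (hG (c • f)).unique ((hG f).const_smul hp c) }
    have := finiteDimensional_supportedSums hsupp a b
    obtain ⟨X, hXc, hX⟩ := exists_finset_card_eq_forall_eq_zero T (indexSet N M a b).card ⊤
      (by rw [finrank_top]; exact finrank_supportedSums_le hsupp a b)
    refine ⟨fun f hf => ?_, X, hXc, fun f₁ hf₁ f₂ hf₂ g₁ g₂ h₁ h₂ heq => ?_⟩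
    · exact ⟨_, hG ⟨f, targets_subset_supportedSums φ a b hf⟩, fun g hg => hg.unique (hG _)⟩
    · let F₁ : supportedSums φ a b := ⟨f₁, targets_subset_supportedSums φ a b hf₁⟩
      let F₂ : supportedSums φ a b := ⟨f₂, targets_subset_supportedSums φ a b hf₂⟩
      have e₁ : T F₁ = g₁ := (hG F₁).unique h₁
      have e₂ : T F₂ = g₂ := (hG F₂).unique h₂
      have hT : T (F₁ - F₂) = 0 := hX _ trivial fun x hx => by
        rw [map_sub, e₁, e₂, Pi.sub_apply, heq x hx, sub_self]
      have hzero : ((F₁ - F₂ : supportedSums φ a b) : L2Plane) = 0 := by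
        refine eq_zero_of_radon_ae_eq_zero hsupp (F₁ - F₂).2.1.choose_spec (F₁ - F₂).2.2 hp hy0
          hinj ?_
        have h := (hG (F₁ - F₂)).2
        rw [show G (F₁ - F₂) = 0 from hT] at h
        exact h.symm
      exact sub_eq_zero.1 hzero
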